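/- Let $X=[0,b)$ with $b>0$, and let $f\colon X\to X$ be an interval exchange transformation (IET), i.e. a right continuous bijection with finitely many discontinuities which is a local translation at every point of continuity. Assume that $f$ is minimal, i.e. every orbit $\{f^k(x)\mid k\in\mathbb Z\}$ is dense in $X$. For $0<t<b$ let $f_t\colon[0,t)\to[0,t)$ be the first return map induced by $f$ on $[0,t)$. For an ergodic $f$-invariant Borel probability measure $\mu$ on $X$, call $f_t$ weakly mixing relative to $\mu$ if, with respect to the normalized restriction of $\mu$ to $[0,t)$, it is measure preserving and ergodic and every measurable $g\colon[0,t)\to\mathbb C$ with $g\circ f_t=\theta g$ almost everywhere for some $\theta\in\mathbb C$ is almost everywhere constant. Then the set $\mathcal M_{\mathrm{erg}}(f)$ of ergodic $f$-invariant Borel probability measures on $X$ is finite, and the set $$\{0<t<b \mid f_t \text{ is weakly mixing relative to every } \mu\in\mathcal M_{\mathrm{erg}}(f)\}=\bigcap_{\mu\in\mathcal M_{\mathrm{erg}}(f)}\{0<t<b\mid f_t\text{ is weakly mixing relative to }\mu\}$$ is a residual subset of $X$ (it contains a countable intersection of dense open subsets of $X$). -/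

import Mathlib

open Set Filter Topology MeasureTheory

/-- `f` is an interval exchange transformation of `X = [0, b)`: a right continuous bijection of `X`
with finitely many discontinuities which has derivative one, that is, is locally a translation,
at each point where it is continuous. -/
structure IsIET {b : ℝ} (f : Equiv.Perm (Ico (0 : ℝ) b)) : Prop where
  right_continuous : ∀ x, ContinuousWithinAt f (Ici x) x
  finite_discontinuities : {x | ¬ ContinuousAt f x}.Finite
  local_translation : ∀ x, ContinuousAt f x →
    ∀ᶠ y in 𝓝 x, (f y : ℝ) - (f x : ℝ) = (y : ℝ) - (x : ℝ)

/-- `f` is minimal: every (two-sided) orbit is dense. -/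
def IsMinimalPerm {α : Type*} [TopologicalSpace α] (f : Equiv.Perm α) : Prop :=
  ∀ x : α, Dense (range fun k : ℤ => (f ^ k) x)

open Classical in
/-- The map induced by `f` on `A`: a point of `A` goes to the first point of its forward orbit, at a
positive time, that lies in `A`. (A point that never returns is fixed, by convention.) -/
noncomputable def inducedMap {α : Type*} (f : α → α) (A : Set α) (x : A) : A :=
  if h : ∃ n : ℕ, 0 < n ∧ f^[n] (x : α) ∈ A then
    ⟨f^[Nat.find h] (x : α), (Nat.find_spec h).2⟩
  else x

/-- The normalized restriction of `μ` to `A`, as a measure on the subtype `A`: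
it gives to `B ⊆ A` the mass `μ B / μ A`. -/
noncomputable def inducedMeasure {α : Type*} [MeasurableSpace α] (μ : Measure α) (A : Set α) :
    Measure A :=
  (μ A)⁻¹ • μ.comap (Subtype.val : A → α)

/-- `T` is weakly mixing with respect to the probability measure `μ`: it preserves `μ`, is ergodic,
and every measurable eigenfunction is almost everywhere constant. -/
structure IsWeaklyMixing {α : Type*} [MeasurableSpace α] (T : α → α) (μ : Measure α) : Prop where
  isProbabilityMeasure : IsProbabilityMeasure μ
  ergodic : Ergodic T μ
  eigenfunction_const : ∀ (θ : ℂ) (g : α → ℂ), Measurable g →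
    (∀ᵐ x ∂μ, g (T x) = θ * g x) → ∃ c : ℂ, ∀ᵐ x ∂μ, g x = c

/-- The set of ergodic `f`-invariant probability measures. -/
def ergodicMeasures {α : Type*} [MeasurableSpace α] (f : α → α) : Set (Measure α) :=
  {μ | IsProbabilityMeasure μ ∧ Ergodic f μ}

/-- The set of those `0 < t < b` for which the map induced by `f` on `[0, t)` is
weakly mixing relative to `μ`. -/
def weakMixingSet {b : ℝ} (f : Equiv.Perm (Ico (0 : ℝ) b)) (μ : Measure (Ico (0 : ℝ) b)) :
    Set (Ico (0 : ℝ) b) :=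
  {t | 0 < (t : ℝ) ∧ IsWeaklyMixing (inducedMap f (Iio t)) (inducedMeasure μ (Iio t))}

/-! Weak mixing. Let `μ` be ergodic and let `g` be an eigenfunction of `f_t` with eigenvalue `θ`.
Extending `g` to be constant along each orbit up to its first entry into `[0, t)` gives `G` on `X`
with `G ∘ f = θ ^ 1_{[0, t)} * G`, so that `G (f^[r] x) = θ ^ visits f t r x * G x`. Suppose that at
some time `r` the points of two sets of measure at least `1 / M` come back very close to themselves,
having visited `[0, t)` exactly `s` times on one set and `s + 1` times on the other
(`SplitsVisits`). As `G` is uniformly continuous up to a set of small measure, both `θ ^ s` and `θ ^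
(s + 1)` are close to `1`. If `M` stays fixed while the closeness improves, `θ = 1`
(`eq_one_of_splitsVisits`), and ergodicity makes `G` constant (`isWeaklyMixing_inducedMap`).

Such `t` are generic (`dense_interior_splitsVisits`). The first return map to an interval `I` has a
number of branches bounded in terms of the discontinuities of `f` alone. Hence over any short `I`
some column, with base `J` and height `h`, carries a definite share of `μ`, and some branch `K` of
the return to `J`, with return time `r`, carries a definite share of `J`. For `τ` in `K` put `t =
f^[h] τ`, a point of `I`. A point on a level of the column over `K` returns to the same level of the
column over `J` after time `r`, and its number of visits to `[0, t)` depends only on the side of `τ`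
on which its base point lies (`exists_visits_eq`). Letting `τ` vary in the middle of `K` gives an
open set of `t`.

Finiteness. Distinct ergodic measures are mutually singular, hence linearly independent. A linear
relation between their masses on the intervals of continuity makes the combined distribution
function invariant under `f`, so it vanishes by minimality (`sum_measureReal_Iio_eq_zero`). Thus
there are at most as many ergodic measures as such intervals, and finitely many residual sets
intersect in a residual set. -/

/-! ### Translations and intervals of continuity. -/

/-- `g` restricts to a translation on `s`. -/
def IsTranslationOn {b : ℝ} (g : Ico (0 : ℝ) b → Ico (0 : ℝ) b) (s : Set (Ico (0 : ℝ) b)) : Prop :=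
  ∀ x ∈ s, ∀ y ∈ s, (g x : ℝ) - g y = (x : ℝ) - y

namespace IsTranslationOn

variable {b : ℝ} {g : Ico (0 : ℝ) b → Ico (0 : ℝ) b} {s : Set (Ico (0 : ℝ) b)}

lemma lt_iff_lt (hg : IsTranslationOn g s) {x y : Ico (0 : ℝ) b} (hx : x ∈ s) (hy : y ∈ s) :
    g x < g y ↔ x < y := by
  have := hg x hx y hy
  rw [← Subtype.coe_lt_coe, ← Subtype.coe_lt_coe]
  constructor <;> intro <;> linarith

/-- The image of an order-convex set under a translation is order-convex. -/
lemma exists_mem_eq (hs : s.OrdConnected) (hg : IsTranslationOn g s) {x y w : Ico (0 : ℝ) b}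
    (hx : x ∈ s) (hy : y ∈ s) (hxw : g x ≤ w) (hwy : w ≤ g y) :
    ∃ z ∈ s, g z = w ∧ x ≤ z ∧ z ≤ y := by
  have hxy := hg x hx y hy
  have h1 : (g x : ℝ) ≤ w := hxw
  have h2 : (w : ℝ) ≤ g y := hwy
  let z : Ico (0 : ℝ) b := ⟨x + (w - g x), by linarith [x.2.1], by linarith [y.2.2]⟩
  have hxz : x ≤ z := by rw [← Subtype.coe_le_coe]; simp only [z]; linarith
  have hzy : z ≤ y := by rw [← Subtype.coe_le_coe]; simp only [z]; linarith
  have hz : z ∈ s := hs.out hx hy ⟨hxz, hzy⟩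
  refine ⟨z, hz, ?_, hxz, hzy⟩
  have := hg z hz x hx
  apply Subtype.ext
  simp only [z] at this ⊢
  linarith

/-- A point missed by the image of an order-convex set lies on one side of it. -/
lemma lt_iff_lt_of_forall_ne (hs : s.OrdConnected) (hg : IsTranslationOn g s)
    {w : Ico (0 : ℝ) b} (hw : ∀ z ∈ s, g z ≠ w) {x y : Ico (0 : ℝ) b} (hx : x ∈ s) (hy : y ∈ s) :
    g x < w ↔ g y < w := by
  have key : ∀ x ∈ s, ∀ y ∈ s, g x < w → g y < w := by
    intro x hx y hy h
    by_contra h'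
    obtain ⟨z, hz, hzw, -⟩ := exists_mem_eq hs hg hx hy h.le (not_lt.1 h')
    exact hw z hz hzw
  exact ⟨key x hx y hy, key y hy x hx⟩

end IsTranslationOn

lemma IsIET.sub_eq {b : ℝ} {f : Equiv.Perm (Ico (0 : ℝ) b)} (hf : IsIET f) {u z : Ico (0 : ℝ) b}
    (huz : u < z) (hc : ∀ d ∈ Ioc u z, ContinuousAt f d) :
    (f z : ℝ) - f u = (z : ℝ) - u := by
  have hpre : IsPreconnected (Ioc u z) := by
    rw [← Topology.IsInducing.subtypeVal.isPreconnected_image]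
    have : (Subtype.val : Ico (0 : ℝ) b → ℝ) '' Ioc u z = Ioc (u : ℝ) z := by
      ext w
      constructor
      · rintro ⟨v, hv, rfl⟩
        exact hv
      · intro hw
        exact ⟨⟨w, u.2.1.trans hw.1.le, hw.2.trans_lt z.2.2⟩, hw, rfl⟩
    rw [this]
    exact isPreconnected_Ioc
  have hconst : ∀ x ∈ Ioc u z, (f x : ℝ) - x = f z - z := by
    intro x hx
    have := hpre.induction₂ (fun x y => (f y : ℝ) - f x = (y : ℝ) - x)
      (fun x hx => nhdsWithin_le_nhds (hf.local_translation x (hc x hx)))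
      (fun _ _ _ _ _ _ h1 h2 => by linarith) (fun _ _ _ _ h => by linarith)
      hx (right_mem_Ioc.2 huz)
    linarith
  -- Right continuity carries the formula to the left end `u`, which may be a discontinuity itself.
  have : (𝓝[>] u).NeBot := inferInstance
  have h1 : Tendsto (fun x => (f x : ℝ) - x) (𝓝[>] u) (𝓝 ((f u : ℝ) - u)) := by
    have h2 : Tendsto f (𝓝[>] u) (𝓝 (f u)) :=
      (hf.right_continuous u).mono_left (nhdsWithin_mono _ Ioi_subset_Ici_self)
    exact (continuous_subtype_val.continuousAt.tendsto.comp h2).sub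
      (continuous_subtype_val.continuousAt.tendsto.mono_left nhdsWithin_le_nhds)
  have h2 : Tendsto (fun x => (f x : ℝ) - x) (𝓝[>] u) (𝓝 ((f z : ℝ) - z)) := by
    refine tendsto_const_nhds.congr' ?_
    filter_upwards [Ioc_mem_nhdsGT huz] with x hx using (hconst x hx).symm
  have := tendsto_nhds_unique h1 h2
  linarith

lemma IsIET.isTranslationOn_iterate_succ {b : ℝ} {f : Equiv.Perm (Ico (0 : ℝ) b)} (hf : IsIET f)
    {n : ℕ} {u v : Ico (0 : ℝ) b} (hn : IsTranslationOn f^[n] (Ico u v))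
    (hc : ∀ y ∈ Ioo u v, ContinuousAt f (f^[n] y)) : IsTranslationOn f^[n + 1] (Ico u v) := by
  have key : ∀ x ∈ Ico u v, ∀ y ∈ Ico u v, x < y →
      (f^[n + 1] y : ℝ) - f^[n + 1] x = (y : ℝ) - x := by
    intro x hx y hy hxy
    rw [Function.iterate_succ_apply', Function.iterate_succ_apply', ← hn y hy x hx]
    refine hf.sub_eq ((hn.lt_iff_lt hx hy).2 hxy) fun d hd => ?_
    obtain ⟨z, hz, rfl, hxz, -⟩ := hn.exists_mem_eq ordConnected_Ico hx hy hd.1.le hd.2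
    have : x ≠ z := by rintro rfl; exact lt_irrefl _ hd.1
    exact hc z ⟨hx.1.trans_lt (lt_of_le_of_ne hxz this), hz.2⟩
  intro x hx y hy
  rcases lt_trichotomy x y with h | rfl | h
  · linarith [key x hx y hy h]
  · simp
  · exact key y hy x hx h

/-! ### Return pieces and the points that separate them. -/

/-- The time `r` is a common first return time to `I` of the points of `Ico u v`, and the orbit of
`Ico u v` moves by translations until that time. -/
structure IsReturnPiece {b : ℝ} (f : Ico (0 : ℝ) b → Ico (0 : ℝ) b) (I : Set (Ico (0 : ℝ) b))
    (u v : Ico (0 : ℝ) b) (r : ℕ) : Prop where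
  lt : u < v
  subset : Ico u v ⊆ I
  pos : 1 ≤ r
  translation : ∀ j ≤ r, IsTranslationOn f^[j] (Ico u v)
  notMem : ∀ j, 1 ≤ j → j < r → ∀ x ∈ Ico u v, f^[j] x ∉ I
  mem : ∀ x ∈ Ico u v, f^[r] x ∈ I

/-- The points of `I` whose orbit meets `Z` no later than it comes back to `I`. -/
def firstHits {α : Type*} (f : α → α) (I Z : Set α) : Set α :=
  {y ∈ I | ∃ j, (∀ i, 1 ≤ i → i ≤ j → f^[i] y ∉ I) ∧ f^[j] y ∈ Z}

/-- A point `y` is recovered from the point of `Z` it hits: running the orbit backwards from there,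
`y` is the first point met in `I`. -/
lemma firstHits_encard_le {α : Type*} {f : α → α} (hf : f.Injective) (I Z : Set α) :
    (firstHits f I Z).encard ≤ Z.encard := by
  have : ∀ y : firstHits f I Z, ∃ j, (∀ i, 1 ≤ i → i ≤ j → f^[i] (y : α) ∉ I) ∧ f^[j] (y : α) ∈ Z :=
    fun y => y.2.2
  choose j hj hjZ using this
  have key : ∀ y y' : firstHits f I Z, j y ≤ j y' → f^[j y] (y : α) = f^[j y'] (y' : α) →
      y = y' := by
    intro y y' hle h
    obtain ⟨k, hk⟩ := Nat.exists_eq_add_of_le hle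
    rw [hk, Function.iterate_add_apply] at h
    have h' := hf.iterate _ h
    rcases Nat.eq_zero_or_pos k with rfl | hpos
    · exact Subtype.ext h'
    · exact absurd (h' ▸ y.2.1) (hj y' k hpos (by omega))
  have hinj : Function.Injective fun y : firstHits f I Z => (⟨f^[j y] y, hjZ y⟩ : Z) := by
    intro y y' h
    have h := congrArg Subtype.val h
    rcases le_total (j y) (j y') with hle | hle
    · exact key y y' hle h
    · exact (key y' y hle h.symm).symm
  exact ENat.card_le_card_of_injective hinj

lemma exists_partition_Ico {α : Type*} [LinearOrder α] {p q : α} (hpq : p < q) (C : Set α)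
    (hC : C.Finite) : ∃ P : Finset (α × α), P.card ≤ C.ncard + 1 ∧
      (∀ x ∈ Ico p q, ∃ J ∈ P, x ∈ Ico J.1 J.2) ∧
      ∀ J ∈ P, J.1 < J.2 ∧ Ico J.1 J.2 ⊆ Ico p q ∧ ∀ y ∈ Ioo J.1 J.2, y ∉ C := by
  classical
  let S : Finset α := insert p (hC.toFinset.filter (· ∈ Ico p q))
  have hS : ∀ c ∈ S, c ∈ Ico p q := by
    intro c hc
    rcases Finset.mem_insert.1 hc with rfl | hc
    · exact left_mem_Ico.2 hpq
    · exact (Finset.mem_filter.1 hc).2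
  have hne : ∀ c : S, ((insert q S).filter (c.1 < ·)).Nonempty := fun c =>
    ⟨q, Finset.mem_filter.2 ⟨Finset.mem_insert_self _ _, (hS c c.2).2⟩⟩
  let next : S → α := fun c => ((insert q S).filter (c.1 < ·)).min' (hne c)
  have hnext : ∀ c : S, c.1 < next c ∧ next c ≤ q ∧ ∀ d ∈ S, c.1 < d → next c ≤ d := by
    intro c
    refine ⟨(Finset.mem_filter.1 (Finset.min'_mem _ (hne c))).2, ?_, ?_⟩
    · exact Finset.min'_le _ _
        (Finset.mem_filter.2 ⟨Finset.mem_insert_self _ _, (hS c c.2).2⟩)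
    · intro d hd hcd
      exact Finset.min'_le _ _ (Finset.mem_filter.2 ⟨Finset.mem_insert_of_mem hd, hcd⟩)
  refine ⟨S.attach.image fun c => (c.1, next c), ?_, ?_, ?_⟩
  · calc _ ≤ S.attach.card := Finset.card_image_le
      _ = S.card := Finset.card_attach
      _ ≤ _ := (Finset.card_insert_le _ _).trans (by
        rw [Set.ncard_eq_toFinset_card C hC]
        gcongr
        exact Finset.filter_subset _ _)
  · intro x hx
    have hne' : (S.filter (· ≤ x)).Nonempty :=
      ⟨p, Finset.mem_filter.2 ⟨Finset.mem_insert_self _ _, hx.1⟩⟩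
    obtain ⟨c, hcx, hmax⟩ : ∃ c ∈ S.filter (· ≤ x), ∀ d ∈ S.filter (· ≤ x), d ≤ c :=
      ⟨_, Finset.max'_mem _ hne', fun d hd => Finset.le_max' _ d hd⟩
    rw [Finset.mem_filter] at hcx
    refine ⟨(c, next ⟨c, hcx.1⟩), Finset.mem_image.2 ⟨⟨c, hcx.1⟩, Finset.mem_attach _ _, rfl⟩,
      hcx.2, ?_⟩
    by_contra hlt
    have hmin := Finset.min'_mem _ (hne ⟨c, hcx.1⟩)
    rw [Finset.mem_filter, Finset.mem_insert] at hmin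
    rcases hmin.1 with h | h
    · exact hlt (hx.2.trans_eq h.symm)
    · exact absurd (hmax _ (Finset.mem_filter.2 ⟨h, not_lt.1 hlt⟩)) (not_le.2 hmin.2)
  · intro J hJ
    obtain ⟨c, -, rfl⟩ := Finset.mem_image.1 hJ
    have hc := hS c c.2
    obtain ⟨h1, h2, h3⟩ := hnext c
    refine ⟨h1, Ico_subset_Ico hc.1 h2, fun y hy hyC => ?_⟩
    have : y ∈ S := Finset.mem_insert_of_mem (Finset.mem_filter.2
      ⟨hC.mem_toFinset.2 hyC, hc.1.trans hy.1.le, hy.2.trans_le h2⟩)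
    exact absurd (h3 y this hy.1) (not_le.2 hy.2)

/-! ### Invariant measures of a minimal bijection. -/

lemma Equiv.Perm.measurable_symm_of_standardBorel {α : Type*} [MeasurableSpace α]
    [StandardBorelSpace α] {f : Equiv.Perm α} (hf : Measurable f) : Measurable f.symm := by
  intro s hs
  rw [← Equiv.image_eq_preimage_symm]
  exact (hf.measurableEmbedding f.injective).measurableSet_image.2 hs

lemma Equiv.Perm.measurableEmbedding_iterate {α : Type*} [MeasurableSpace α]
    [StandardBorelSpace α] {f : Equiv.Perm α} (hf : Measurable f) (n : ℕ) :
    MeasurableEmbedding f^[n] :=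
  (hf.iterate n).measurableEmbedding (f.injective.iterate n)

lemma MeasureTheory.MeasurePreserving.measure_image_iterate {α : Type*} [MeasurableSpace α]
    [StandardBorelSpace α] {f : Equiv.Perm α} {μ : Measure α} (hf : MeasurePreserving f μ μ)
    (n : ℕ) {s : Set α} (hs : MeasurableSet s) : μ (f^[n] '' s) = μ s := by
  rw [← (hf.iterate n).measure_preimage
    ((Equiv.Perm.measurableEmbedding_iterate hf.measurable n).measurableSet_image.2
      hs).nullMeasurableSet, preimage_image_eq _ (f.injective.iterate n)]

lemma MeasureTheory.MeasurePreserving.perm_zpow {α : Type*} [MeasurableSpace α]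
    [StandardBorelSpace α] {f : Equiv.Perm α} {μ : Measure α} (hf : MeasurePreserving f μ μ)
    (k : ℤ) : MeasurePreserving (f ^ k) μ μ := by
  let e : α ≃ᵐ α := ⟨f, hf.measurable, Equiv.Perm.measurable_symm_of_standardBorel hf.measurable⟩
  have he : MeasurePreserving f.symm μ μ := MeasurePreserving.symm e hf
  obtain ⟨n, rfl | rfl⟩ := k.eq_nat_or_neg
  · rw [zpow_natCast, ← Equiv.Perm.iterate_eq_pow]
    exact hf.iterate n
  · rw [zpow_neg, zpow_natCast, ← inv_pow, ← Equiv.Perm.iterate_eq_pow]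
    exact he.iterate n

instance instStandardBorelSpaceIco (a b : ℝ) : StandardBorelSpace (Ico a b) :=
  measurableSet_Ico.standardBorel

/-- Every orbit meets `U`, so countably many translates of `U`, all of the same mass, cover the
space. -/
lemma IsMinimalPerm.measure_ne_zero {α : Type*} [TopologicalSpace α] [MeasurableSpace α]
    [StandardBorelSpace α] {f : Equiv.Perm α} (hmin : IsMinimalPerm f) {μ : Measure α}
    (hμ0 : μ ≠ 0) (hμ : MeasurePreserving f μ μ) {U : Set α} (hU : IsOpen U)
    (hUm : MeasurableSet U) (hne : U.Nonempty) : μ U ≠ 0 := by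
  intro h0
  apply hμ0
  rw [← Measure.measure_univ_eq_zero]
  have : (univ : Set α) ⊆ ⋃ k : ℤ, (f ^ k) ⁻¹' U := by
    intro x _
    obtain ⟨_, hy, k, rfl⟩ := (hmin x).inter_open_nonempty U hU hne
    exact mem_iUnion.2 ⟨k, hy⟩
  refine measure_mono_null this (measure_iUnion_null fun k => ?_)
  rw [(hμ.perm_zpow k).measure_preimage hUm.nullMeasurableSet, h0]

/-- A dense orbit is infinite, and all its points have the same mass. -/
lemma IsMinimalPerm.measure_singleton {α : Type*} [TopologicalSpace α] [T1Space α] [Infinite α]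
    [MeasurableSpace α] [StandardBorelSpace α] {f : Equiv.Perm α}
    (hmin : IsMinimalPerm f) {μ : Measure α} [IsFiniteMeasure μ] (hμ : MeasurePreserving f μ μ)
    (x : α) : μ {x} = 0 := by
  by_contra h0
  have hinf : (range fun k : ℤ => (f ^ k) x).Infinite := by
    intro hfin
    have := (hmin x).closure_eq
    rw [hfin.isClosed.closure_eq] at this
    exact infinite_univ (this ▸ hfin)
  refine measure_ne_top μ _ (hinf.meas_eq_top ⟨μ {x}, h0, ?_⟩)
  rintro _ ⟨k, rfl⟩
  rw [← (hμ.perm_zpow k).measure_preimage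
    (measurableSet_singleton ((f ^ k) x)).nullMeasurableSet]
  exact measure_mono (singleton_subset_iff.2 rfl)

lemma ENNReal.exists_le_mul_of_le_sum {ι : Type*} {P : Finset ι} {N : ℕ} (hP : P.card ≤ N)
    {w : ι → ENNReal} {a : ENNReal} (ha : a ≠ 0) (haw : a ≤ ∑ i ∈ P, w i) :
    ∃ i ∈ P, a ≤ N * w i := by
  have hne : P.Nonempty := by
    rw [Finset.nonempty_iff_ne_empty]
    rintro rfl
    exact ha (le_zero_iff.1 (by simpa using haw))
  obtain ⟨i, hi, hmax⟩ := P.exists_max_image w hne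
  refine ⟨i, hi, haw.trans ?_⟩
  calc ∑ j ∈ P, w j ≤ P.card • w i := Finset.sum_le_card_nsmul _ _ _ hmax
    _ ≤ N * w i := by rw [nsmul_eq_mul]; gcongr

/-! ### Columns over an interval, with bounds uniform in the interval. -/

section

variable {b : ℝ} {f : Equiv.Perm (Ico (0 : ℝ) b)} {μ : Measure (Ico (0 : ℝ) b)}

/-- The number of return pieces to an interval is bounded by this constant. -/
noncomputable def pieceBound (f : Equiv.Perm (Ico (0 : ℝ) b)) : ℕ :=
  {x | ¬ ContinuousAt f x}.ncard + 3

/-- Let `r` be the least time at which some point of the piece returns, which exists by Poincaré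
recurrence. Before `r` no interior point meets a discontinuity, so `f^[r]` translates the piece. Its
image meets `Ico p q`, and leaving it would send an interior point to `p` or `q`. Since `p` lies in
`Ico p q`, a hit of `p` is recorded one step earlier, at `f.symm p`. -/
lemma IsIET.exists_isReturnPiece (hf : IsIET f) [IsFiniteMeasure μ] (hμ : MeasurePreserving f μ μ)
    {p q u v : Ico (0 : ℝ) b} (huv : u < v) (hsub : Ico u v ⊆ Ico p q) (hpos : μ (Ico u v) ≠ 0)
    (hC : ∀ y ∈ Ioo u v, y ∉ firstHits f (Ico p q) ({x | ¬ ContinuousAt f x} ∪ {q, f.symm p})) :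
    ∃ r, IsReturnPiece f (Ico p q) u v r := by
  classical
  have hex : ∃ m, 1 ≤ m ∧ ∃ x ∈ Ico u v, f^[m] x ∈ Ico p q := by
    obtain ⟨x, hx, m, hm, hmx⟩ :=
      hμ.exists_mem_iterate_mem measurableSet_Ico.nullMeasurableSet hpos
    exact ⟨m, Nat.one_le_iff_ne_zero.2 hm, x, hx, hsub hmx⟩
  let r := Nat.find hex
  obtain ⟨hr1, x, hx, hrx⟩ : 1 ≤ r ∧ ∃ x ∈ Ico u v, f^[r] x ∈ Ico p q := Nat.find_spec hex
  have hnot : ∀ j, 1 ≤ j → j < r → ∀ x ∈ Ico u v, f^[j] x ∉ Ico p q := fun j hj hjr x hx h =>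
    Nat.find_min hex hjr ⟨hj, x, hx, h⟩
  have htr : ∀ j ≤ r, IsTranslationOn f^[j] (Ico u v) := by
    intro j
    induction j with
    | zero => intro _ x _ y _; rfl
    | succ j ih =>
      intro hj
      refine hf.isTranslationOn_iterate_succ (ih (by omega)) fun y hy => ?_
      by_contra hd
      exact hC y hy ⟨hsub (Ioo_subset_Ico_self hy), j,
        fun i hi hij => hnot i hi (by omega) y (Ioo_subset_Ico_self hy), Or.inl hd⟩
  refine ⟨r, huv, hsub, hr1, htr, hnot, fun z hz => ?_⟩
  have htr' := htr r le_rfl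
  by_contra hzr
  rcases lt_or_ge (f^[r] z) p with h | h
  · obtain ⟨y, hy, hyp, hzy, -⟩ := htr'.exists_mem_eq ordConnected_Ico hz hx h.le hrx.1
    have hzy' : z ≠ y := by rintro rfl; exact lt_irrefl _ (hyp ▸ h)
    obtain ⟨k, hk⟩ := Nat.exists_eq_add_of_le' hr1
    refine hC y ⟨hz.1.trans_lt (lt_of_le_of_ne hzy hzy'), hy.2⟩ ⟨hsub hy, k,
      fun i hi hik => hnot i hi (by omega) y hy, Or.inr (Or.inr ?_)⟩
    rw [hk, Function.iterate_succ_apply'] at hyp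
    rw [mem_singleton_iff, Equiv.eq_symm_apply, hyp]
  · have h' : q ≤ f^[r] z := not_lt.1 fun h' => hzr ⟨h, h'⟩
    obtain ⟨y, hy, hyq, hxy, -⟩ := htr'.exists_mem_eq ordConnected_Ico hx hz hrx.2.le h'
    have hxy' : x ≠ y := by rintro rfl; exact lt_irrefl _ (hyq ▸ hrx.2)
    refine hC y ⟨hx.1.trans_lt (lt_of_le_of_ne hxy hxy'), hy.2⟩ ⟨hsub hy, r,
      fun i hi hir => ?_, Or.inr (Or.inl hyq)⟩
    rcases hir.lt_or_eq with h | rfl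
    · exact hnot i hi h y hy
    · rw [hyq]
      exact fun h => lt_irrefl _ h.2

/-- An interval is cut into a bounded number of pieces with constant return times. -/
lemma IsIET.exists_returnPieces (hf : IsIET f) [IsFiniteMeasure μ] (hμ : MeasurePreserving f μ μ)
    (hpos : ∀ u v, u < v → μ (Ico u v) ≠ 0) {p q : Ico (0 : ℝ) b} (hpq : p < q) :
    ∃ P : Finset (Ico (0 : ℝ) b × Ico (0 : ℝ) b), P.card ≤ pieceBound f ∧
      (∀ x ∈ Ico p q, ∃ J ∈ P, x ∈ Ico J.1 J.2) ∧
      ∀ J ∈ P, ∃ r, IsReturnPiece f (Ico p q) J.1 J.2 r := by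
  have hfin := hf.finite_discontinuities
  set D := {x | ¬ ContinuousAt f x} with hD
  set C := firstHits f (Ico p q) (D ∪ {q, f.symm p}) with hC
  have hle : C.encard ≤ (D.ncard + 2 : ℕ) := by
    refine (firstHits_encard_le f.injective _ _).trans ((encard_union_le _ _).trans ?_)
    rw [← hfin.cast_ncard_eq]
    push_cast
    gcongr
    refine (encard_insert_le _ _).trans ?_
    rw [encard_singleton, one_add_one_eq_two]
  have hCfin : C.Finite := finite_of_encard_le_coe hle
  obtain ⟨P, hcard, hcov, hP⟩ := exists_partition_Ico hpq C hCfin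
  refine ⟨P, ?_, hcov, fun J hJ => ?_⟩
  · rw [← hCfin.cast_ncard_eq, Nat.cast_le] at hle
    change _ ≤ D.ncard + 3
    omega
  · obtain ⟨h1, h2, h3⟩ := hP J hJ
    exact hf.exists_isReturnPiece hμ h1 h2 (hpos _ _ h1) h3

lemma IsIET.exists_returnPiece_measure_le (hf : IsIET f) [IsFiniteMeasure μ]
    (hμ : MeasurePreserving f μ μ) (hpos : ∀ u v, u < v → μ (Ico u v) ≠ 0) {p q : Ico (0 : ℝ) b}
    (hpq : p < q) : ∃ u v r, IsReturnPiece f (Ico p q) u v r ∧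
      μ (Ico p q) ≤ pieceBound f * μ (Ico u v) := by
  obtain ⟨P, hcard, hcov, hP⟩ := hf.exists_returnPieces hμ hpos hpq
  obtain ⟨J, hJ, hle⟩ := ENNReal.exists_le_mul_of_le_sum hcard (hpos p q hpq)
    (w := fun J => μ (Ico J.1 J.2)) <| by
      refine (measure_mono ?_).trans (measure_biUnion_finset_le P fun J => Ico J.1 J.2)
      intro x hx
      obtain ⟨J, hJ, hxJ⟩ := hcov x hx
      exact mem_iUnion₂.2 ⟨J, hJ, hxJ⟩
  obtain ⟨r, hr⟩ := hP J hJ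
  exact ⟨J.1, J.2, r, hr, hle⟩

/-- Some column over an interval carries a definite proportion of an ergodic measure. -/
lemma IsIET.exists_returnPiece_tower (hf : IsIET f) [IsProbabilityMeasure μ] (hμ : Ergodic f μ)
    (hpos : ∀ u v, u < v → μ (Ico u v) ≠ 0) {p q : Ico (0 : ℝ) b} (hpq : p < q) :
    ∃ u v r, IsReturnPiece f (Ico p q) u v r ∧ 1 ≤ pieceBound f * (r * μ (Ico u v)) := by
  obtain ⟨P, hcard, hcov, hP⟩ := hf.exists_returnPieces hμ.toMeasurePreserving hpos hpq
  choose! r hr using hP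
  -- The union of all columns is mapped into itself by `f` and contains `Ico p q`, so ergodicity
  -- gives it full measure; one of the boundedly many columns then has a definite share.
  let U := ⋃ J ∈ P, ⋃ j ∈ Finset.range (r J), f^[j] '' Ico J.1 J.2
  have hUm : MeasurableSet U := by
    refine P.measurableSet_biUnion fun J _ => Finset.measurableSet_biUnion _ fun j _ => ?_
    exact (Equiv.Perm.measurableEmbedding_iterate hμ.measurable j).measurableSet_image.2
      measurableSet_Ico
  have hIU : Ico p q ⊆ U := by
    intro x hx
    obtain ⟨J, hJ, hxJ⟩ := hcov x hx
    exact mem_iUnion₂.2 ⟨J, hJ, mem_iUnion₂.2 ⟨0, Finset.mem_range.2 (hr J hJ).pos, x, hxJ, rfl⟩⟩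
  have hUU : U ⊆ f ⁻¹' U := by
    intro x hx
    obtain ⟨J, hJ, hx⟩ := mem_iUnion₂.1 hx
    obtain ⟨j, hj, y, hy, rfl⟩ := mem_iUnion₂.1 hx
    rw [mem_preimage, ← Function.iterate_succ_apply' f j y]
    rcases (Nat.succ_le_of_lt (Finset.mem_range.1 hj)).lt_or_eq with h | h
    · exact mem_iUnion₂.2 ⟨J, hJ, mem_iUnion₂.2 ⟨j + 1, Finset.mem_range.2 h, y, hy, rfl⟩⟩
    · rw [h]
      exact hIU ((hr J hJ).mem y hy)
  have hU1 : μ U = 1 := by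
    rcases hμ.ae_empty_or_univ_of_ae_le_preimage hUm.nullMeasurableSet
      hUU.eventuallyLE with h | h
    · have h0 := measure_congr h
      rw [measure_empty] at h0
      exact absurd (measure_mono_null hIU h0) (hpos p q hpq)
    · rw [measure_congr h, measure_univ]
  obtain ⟨J, hJ, hle⟩ := ENNReal.exists_le_mul_of_le_sum hcard one_ne_zero
    (w := fun J => r J * μ (Ico J.1 J.2)) <| by
      rw [← hU1]
      refine (measure_biUnion_finset_le _ _).trans (Finset.sum_le_sum fun J _ => ?_)
      refine (measure_biUnion_finset_le _ _).trans (le_of_eq ?_)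
      rw [Finset.sum_congr rfl fun j _ =>
        hμ.toMeasurePreserving.measure_image_iterate j measurableSet_Ico]
      simp
  exact ⟨J.1, J.2, r J, hr J hJ, hle⟩

end

/-! ### Distribution functions of measures without atoms. -/

lemma measureReal_Iio_add_Ico {α : Type*} [LinearOrder α] [TopologicalSpace α] [OrderTopology α]
    [SecondCountableTopology α] [MeasurableSpace α] [BorelSpace α] {μ : Measure α}
    [IsFiniteMeasure μ] {x y : α} (h : x ≤ y) :
    μ.real (Iio x) + μ.real (Ico x y) = μ.real (Iio y) := by
  have hd : Disjoint (Iio x) (Ico x y) := (Iio_disjoint_Ici le_rfl).mono_right Ico_subset_Ici_self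
  rw [← measureReal_union hd measurableSet_Ico, Iio_union_Ico_eq_Iio h]

lemma continuous_measureReal_Iio {ν : Measure ℝ} [IsFiniteMeasure ν] (hν : ∀ x, ν {x} = 0) :
    Continuous fun x : ℝ => ν.real (Iio x) := by
  have : NullSingletonClass ν := ⟨hν⟩
  have h1 := intervalIntegral.continuous_primitive (μ := ν) (f := fun _ => (1 : ℝ))
    (fun _ _ => intervalIntegrable_const) 0
  have h2 : ∀ x : ℝ, ν.real (Iio x) = ν.real (Iio 0) + ∫ _ in (0 : ℝ)..x, (1 : ℝ) ∂ν := by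
    intro x
    rw [intervalIntegral.integral_const', smul_eq_mul, mul_one]
    have key : ∀ x y : ℝ, x ≤ y → ν.real (Iio y) = ν.real (Iio x) + ν.real (Ioc x y) := by
      intro x y hxy
      rw [measureReal_congr (Ico_ae_eq_Ioc (μ := ν) (a := x) (b := y)).symm,
        measureReal_Iio_add_Ico hxy]
    rcases le_total 0 x with h | h
    · rw [Ioc_eq_empty_of_le h, measureReal_empty, sub_zero, key 0 x h]
    · rw [Ioc_eq_empty_of_le h, measureReal_empty, key x 0 h]
      ring
  rw [show (fun x : ℝ => ν.real (Iio x)) = _ from funext h2]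
  exact continuous_const.add h1

section

variable {b : ℝ} {μ : Measure (Ico (0 : ℝ) b)}

lemma map_val_singleton (h0 : ∀ x, μ {x} = 0) (x : ℝ) : μ.map Subtype.val {x} = 0 := by
  rw [Measure.map_apply measurable_subtype_coe (measurableSet_singleton x)]
  have : NullSingletonClass μ := ⟨h0⟩
  refine Set.Subsingleton.measure_zero ?_ _
  intro y hy z hz
  exact Subtype.ext (hy.trans hz.symm)

lemma map_val_Iio (x : Ico (0 : ℝ) b) :
    (μ.map Subtype.val).real (Iio (x : ℝ)) = μ.real (Iio x) := by
  rw [measureReal_def, Measure.map_apply measurable_subtype_coe measurableSet_Iio]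
  rfl

lemma continuous_measureReal_Iio_Ico [IsFiniteMeasure μ] (h0 : ∀ x, μ {x} = 0) :
    Continuous fun x : Ico (0 : ℝ) b => μ.real (Iio x) := by
  simp_rw [← map_val_Iio]
  exact (continuous_measureReal_Iio (map_val_singleton h0)).comp continuous_subtype_val

lemma measureReal_Ico_eq_sub [IsFiniteMeasure μ] {u v : Ico (0 : ℝ) b} (h : u ≤ v) :
    μ.real (Ico u v) = μ.real (Iio v) - μ.real (Iio u) := by
  rw [← measureReal_Iio_add_Ico h]
  ring

lemma exists_measureReal_Iio_eq [IsFiniteMeasure μ] (h0 : ∀ x, μ {x} = 0) {u v : Ico (0 : ℝ) b}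
    (huv : u ≤ v) {m : ℝ} (hm : m ∈ Icc (μ.real (Iio u)) (μ.real (Iio v))) :
    ∃ τ ∈ Icc u v, μ.real (Iio τ) = m := by
  rw [← map_val_Iio, ← map_val_Iio] at hm
  obtain ⟨x, hx, rfl⟩ := intermediate_value_Icc (show (u : ℝ) ≤ v from huv)
    (continuous_measureReal_Iio (map_val_singleton h0)).continuousOn hm
  exact ⟨⟨x, u.2.1.trans hx.1, hx.2.trans_lt v.2.2⟩, hx, (map_val_Iio _).symm⟩

/-- An interval contains a gap with at least a third of the mass on each side. -/
lemma exists_balanced_gap [IsFiniteMeasure μ] (h0 : ∀ x, μ {x} = 0) {u v : Ico (0 : ℝ) b}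
    (huv : u < v) (hpos : μ (Ico u v) ≠ 0) :
    ∃ τ₁ τ₂, u ≤ τ₁ ∧ τ₁ < τ₂ ∧ τ₂ ≤ v ∧ μ (Ico u v) ≤ 3 * μ (Ico u τ₁) ∧
      μ (Ico u v) ≤ 3 * μ (Ico τ₂ v) := by
  have hm : 0 < μ.real (Ico u v) := measureReal_nonneg.lt_of_ne'
    ((measureReal_ne_zero_iff (measure_ne_top _ _)).2 hpos)
  have hsub := measureReal_Ico_eq_sub (μ := μ) huv.le
  obtain ⟨τ₁, h1, h1'⟩ := exists_measureReal_Iio_eq h0 huv.le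
    (m := μ.real (Iio u) + μ.real (Ico u v) / 3) ⟨by linarith, by linarith⟩
  obtain ⟨τ₂, h2, h2'⟩ := exists_measureReal_Iio_eq h0 huv.le
    (m := μ.real (Iio u) + 2 * μ.real (Ico u v) / 3) ⟨by linarith, by linarith⟩
  have conv : ∀ s t : Set (Ico (0 : ℝ) b), μ.real s ≤ 3 * μ.real t → μ s ≤ 3 * μ t := by
    intro s t h
    rw [← ENNReal.toReal_le_toReal (measure_ne_top _ _)
      (ENNReal.mul_ne_top (by norm_num) (measure_ne_top _ _)), ENNReal.toReal_mul]
    exact h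
  refine ⟨τ₁, τ₂, h1.1, ?_, h2.2, conv _ _ ?_, conv _ _ ?_⟩
  · by_contra h
    have := measureReal_mono (μ := μ) (Iio_subset_Iio (not_lt.1 h))
    linarith
  · rw [measureReal_Ico_eq_sub h1.1, h1']
    linarith
  · rw [measureReal_Ico_eq_sub h2.2, h2']
    linarith

/-! ### Visit counts in a column over a column. -/

/-- The number of visits to `Iio t` before time `n`. -/
def visits {α : Type*} [LinearOrder α] (f : α → α) (t : α) (n : ℕ) (x : α) : ℕ :=
  ∑ j ∈ Finset.range n, if f^[j] x < t then 1 else 0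

/-- At some time at which the orbits come `δ`-close to their starting points, the number of visits
to `Iio t` takes two consecutive values, each on a set of measure at least `1 / M`. -/
def SplitsVisits (f : Equiv.Perm (Ico (0 : ℝ) b)) (μ : Measure (Ico (0 : ℝ) b)) (M : ℕ) (δ : ℝ)
    (t : Ico (0 : ℝ) b) : Prop :=
  ∃ r s : ℕ, ∀ e : ℕ, e < 2 → ∃ E : Set (Ico (0 : ℝ) b), 1 ≤ M * μ E ∧
    ∀ x ∈ E, |(f^[r] x : ℝ) - x| < δ ∧ visits f t r x = s + e

end

section

variable {b : ℝ} {f : Equiv.Perm (Ico (0 : ℝ) b)} {μ : Measure (Ico (0 : ℝ) b)}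

/-- The levels of a column over an interval `Ico u v` are disjoint, so they have additive mass. -/
lemma IsReturnPiece.measure_levels (hμ : MeasurePreserving f μ μ) {I : Set (Ico (0 : ℝ) b)}
    {u v : Ico (0 : ℝ) b} {h : ℕ} (hJ : IsReturnPiece f I u v h) {B : Set (Ico (0 : ℝ) b)}
    (hB : MeasurableSet B) (hBJ : B ⊆ Ico u v) :
    μ (⋃ i ∈ Finset.Icc 1 h, f^[i] '' B) = h * μ B := by
  rw [measure_biUnion_finset]
  · rw [Finset.sum_congr rfl fun i _ => hμ.measure_image_iterate i hB]
    simp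
  · have key : ∀ i i', 1 ≤ i → i < i' → i' ≤ h → ∀ x ∈ B, ∀ y ∈ B, f^[i] x ≠ f^[i'] y := by
      intro i i' hi hii hi' x hx y hy hxy
      obtain ⟨k, rfl⟩ := Nat.exists_eq_add_of_lt hii
      rw [add_assoc, Function.iterate_add_apply] at hxy
      have := f.injective.iterate i hxy
      exact hJ.notMem (k + 1) (by omega) (by omega) y (hBJ hy)
        (this ▸ hJ.subset (hBJ hx))
    intro i hi i' hi' hne
    rw [Finset.mem_coe, Finset.mem_Icc] at hi hi'
    refine disjoint_left.2 ?_
    rintro _ ⟨x, hx, rfl⟩ ⟨y, hy, hxy⟩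
    rcases lt_or_gt_of_ne hne with hlt | hlt
    · exact key i i' hi.1 hlt hi'.2 x hx y hy hxy.symm
    · exact key i' i hi'.1 hlt hi.2 y hy x hx hxy
  · intro i _
    exact (Equiv.Perm.measurableEmbedding_iterate hμ.measurable i).measurableSet_image.2 hB

/-- Within a column, the number of visits to `Iio t` during a return to the base only depends on the
side of the base point relative to the preimage of `t`. -/
lemma IsReturnPiece.exists_visits_eq {I : Set (Ico (0 : ℝ) b)}
    {u v u' v' τ : Ico (0 : ℝ) b} {h r : ℕ} (hJ : IsReturnPiece f I u v h)
    (hK : IsReturnPiece f (Ico u v) u' v' r) (hτ : τ ∈ Ico u' v') :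
    ∃ s, ∀ i, 1 ≤ i → i ≤ h → ∀ y ∈ Ico u' v',
      visits f (f^[h] τ) r (f^[i] y) = s + if y < τ then 1 else 0 := by
  classical
  have hu' : u' ∈ Ico u' v' := left_mem_Ico.2 hK.lt
  have htI : f^[h] τ ∈ I := hJ.mem τ (hK.subset hτ)
  have hhr : h ≤ r := by
    by_contra hlt
    exact hJ.notMem r hK.pos (not_le.1 hlt) u' (hK.subset hu') (hJ.subset (hK.mem u' hu'))
  -- An intermediate level misses `I`, hence misses `f^[h] τ`, and so lies on one side of it.
  have hJside : ∀ m, 1 ≤ m → m < h → ∀ x ∈ Ico u v, ∀ y ∈ Ico u v,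
      (f^[m] x < f^[h] τ ↔ f^[m] y < f^[h] τ) := by
    intro m hm hmh x hx y hy
    refine (hJ.translation m hmh.le).lt_iff_lt_of_forall_ne ordConnected_Ico ?_ hx hy
    intro z hz hzt
    exact hJ.notMem m hm hmh z hz (hzt ▸ htI)
  -- Three ranges of `k`: below `h` and above `r` the orbit is on an intermediate level of the
  -- column over `Ico u v`; in between, hitting `f^[h] τ` would bring a point back to `τ` in `Ico u
  -- v` before time `r`. Only time `h` can distinguish base points.
  have hKside : ∀ k, 1 ≤ k → k < r + h → k ≠ h → ∀ y ∈ Ico u' v',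
      (f^[k] y < f^[h] τ ↔ f^[k] u' < f^[h] τ) := by
    intro k hk hkr hkh y hy
    rcases lt_or_ge k h with h1 | h1
    · exact hJside k hk h1 y (hK.subset hy) u' (hK.subset hu')
    rcases le_or_gt k r with h2 | h2
    · refine (hK.translation k h2).lt_iff_lt_of_forall_ne ordConnected_Ico ?_ hy hu'
      intro z hz hzt
      obtain ⟨m, rfl⟩ := Nat.exists_eq_add_of_le h1
      rw [Function.iterate_add_apply] at hzt
      have := f.injective.iterate h hzt
      exact hK.notMem m (by omega) (by have := hJ.pos; omega) z hz (this ▸ hK.subset hτ)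
    · obtain ⟨m, rfl⟩ := Nat.exists_eq_add_of_le' h2.le
      rw [Function.iterate_add_apply, Function.iterate_add_apply]
      exact hJside m (by omega) (by omega) _ (hK.mem y hy) _ (hK.mem u' hu')
  let φ : ℕ → ℕ := fun k => if k ≠ h ∧ f^[k] u' < f^[h] τ then 1 else 0
  have hterm : ∀ k, 1 ≤ k → k < r + h → ∀ y ∈ Ico u' v',
      (if f^[k] y < f^[h] τ then 1 else 0) =
        φ k + if k = h then (if y < τ then 1 else 0) else 0 := by
    intro k hk hkr y hy
    by_cases hkh : k = h
    · subst hkh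
      simp [φ, (hJ.translation k le_rfl).lt_iff_lt (hK.subset hy) (hK.subset hτ)]
    · simp [φ, hkh, hKside k hk hkr hkh y hy]
  have hφ : ∀ k, 1 ≤ k → k < h → φ (k + r) = φ k := by
    intro k hk hkh
    have : f^[k + r] u' < f^[h] τ ↔ f^[k] u' < f^[h] τ := by
      rw [Function.iterate_add_apply]
      exact hJside k hk hkh _ (hK.mem u' hu') _ (hK.subset hu')
    have h1 : k + r ≠ h := by omega
    have h2 : k ≠ h := by omega
    simp [φ, this, h1, h2]
  -- Moving the window of length `r` up one level drops `φ i` and gains `φ (i + r)`, which are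
  -- equal.
  have hsum : ∀ i, 1 ≤ i → i ≤ h →
      ∑ j ∈ Finset.range r, φ (j + i) = ∑ j ∈ Finset.range r, φ (j + 1) := by
    intro i hi
    induction i, hi using Nat.le_induction with
    | base => intro _; rfl
    | succ i hi ih =>
      intro hih
      rw [← ih (by omega)]
      have h1 := Finset.sum_range_succ (fun j => φ (j + i)) r
      have h2 := Finset.sum_range_succ' (fun j => φ (j + i)) r
      have h3 := hφ i hi (by omega)
      simp only [zero_add, add_right_comm _ 1 i] at h2
      simp only [← add_assoc]
      rw [add_comm r i, h3] at h1
      omega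
  refine ⟨∑ j ∈ Finset.range r, φ (j + 1), fun i hi hih y hy => ?_⟩
  rw [visits, ← hsum i hi hih]
  have : ∀ j ∈ Finset.range r, (if f^[j] (f^[i] y) < f^[h] τ then 1 else 0) =
      φ (j + i) + if j = h - i then (if y < τ then 1 else 0) else 0 := by
    intro j hj
    rw [Finset.mem_range] at hj
    rw [← Function.iterate_add_apply, hterm (j + i) (by omega) (by omega) y hy]
    have : j + i = h ↔ j = h - i := by omega
    simp only [this]
  rw [Finset.sum_congr rfl this, Finset.sum_add_distrib, Finset.sum_ite_eq',
    -- The window from `i` to `i + r - 1` contains time `h`, because `1 ≤ i ≤ h ≤ r`.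
    if_pos (Finset.mem_range.2 (by omega))]

lemma IsReturnPiece.splitsVisits (hμ : MeasurePreserving f μ μ)
    {p q u v u' v' τ₁ τ₂ τ : Ico (0 : ℝ) b}
    {h r M : ℕ} {δ : ℝ} (hJ : IsReturnPiece f (Ico p q) u v h)
    (hK : IsReturnPiece f (Ico u v) u' v' r) (hδ : (q : ℝ) - p < δ) (h1 : u' ≤ τ₁) (h2 : τ₂ ≤ v')
    (hτ : τ ∈ Ioo τ₁ τ₂)
    (hM₁ : 1 ≤ M * (h * μ (Ico u' τ₁))) (hM₂ : 1 ≤ M * (h * μ (Ico τ₂ v'))) :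
    SplitsVisits f μ M δ (f^[h] τ) := by
  obtain ⟨s, hs⟩ := hJ.exists_visits_eq hK (τ := τ) ⟨h1.trans hτ.1.le, hτ.2.trans_le h2⟩
  have key : ∀ B ⊆ Ico u' v', MeasurableSet B → 1 ≤ M * (h * μ B) →
      ∀ e, (∀ y ∈ B, (if y < τ then 1 else 0) = e) → ∃ E : Set (Ico (0 : ℝ) b), 1 ≤ M * μ E ∧
        ∀ x ∈ E, |(f^[r] x : ℝ) - x| < δ ∧ visits f (f^[h] τ) r x = s + e := by
    intro B hB hBm hM e he
    refine ⟨⋃ i ∈ Finset.Icc 1 h, f^[i] '' B, ?_, fun x hx => ?_⟩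
    · rwa [hJ.measure_levels hμ hBm (hB.trans hK.subset)]
    · obtain ⟨i, hi, y, hy, rfl⟩ := mem_iUnion₂.1 hx
      rw [Finset.mem_Icc] at hi
      refine ⟨?_, by rw [hs i hi.1 hi.2 y (hB hy), he y hy]⟩
      have hy1 := hK.subset (hB hy)
      have hy2 := hK.mem y (hB hy)
      rw [← Function.iterate_add_apply, add_comm, Function.iterate_add_apply,
        hJ.translation i hi.2 _ hy2 _ hy1]
      have hy1 : (p : ℝ) ≤ y ∧ (y : ℝ) < q := hJ.subset hy1
      have hy2 : (p : ℝ) ≤ f^[r] y ∧ (f^[r] y : ℝ) < q := hJ.subset hy2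
      rw [abs_lt]
      constructor <;> linarith
  refine ⟨r, s, fun e he => ?_⟩
  interval_cases e
  · refine key _ (Ico_subset_Ico_left (h1.trans (hτ.1.trans hτ.2).le)) measurableSet_Ico hM₂ 0
      fun y hy => if_neg (not_lt.2 (hτ.2.le.trans hy.1))
  · exact key _ (Ico_subset_Ico_right ((hτ.1.trans hτ.2).le.trans h2)) measurableSet_Ico hM₁ 1
      fun y hy => if_pos (hy.2.trans hτ.1)

lemma IsTranslationOn.isOpen_image_Ioo {g : Ico (0 : ℝ) b → Ico (0 : ℝ) b} {u v : Ico (0 : ℝ) b}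
    (hg : IsTranslationOn g (Ico u v)) {x y : Ico (0 : ℝ) b} (hux : u ≤ x) (hyv : y ≤ v) :
    IsOpen (g '' Ioo x y) := by
  rw [isOpen_iff_mem_nhds]
  rintro _ ⟨z, hz, rfl⟩
  obtain ⟨z', hz1, hz2⟩ := exists_between hz.2
  have hm : ∀ w ∈ Ico x y, w ∈ Ico u v := fun w hw => ⟨hux.trans hw.1, hw.2.trans_le hyv⟩
  have hx' := hm x ⟨le_rfl, hz.1.trans hz.2⟩
  have hz' := hm z ⟨hz.1.le, hz.2⟩
  have hz'' := hm z' ⟨(hz.1.trans hz1).le, hz2⟩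
  filter_upwards [Ioo_mem_nhds ((hg.lt_iff_lt hx' hz').2 hz.1) ((hg.lt_iff_lt hz' hz'').2 hz1)]
    with w hw
  obtain ⟨t, ht, rfl, -, htz⟩ := hg.exists_mem_eq ordConnected_Ico hx' hz'' hw.1.le hw.2.le
  exact ⟨t, ⟨(hg.lt_iff_lt hx' ht).1 hw.1, htz.trans_lt hz2⟩, rfl⟩

/-- The constant in the measure estimate for `SplitsVisits`. -/
noncomputable def splitBound (f : Equiv.Perm (Ico (0 : ℝ) b)) : ℕ :=
  3 * (pieceBound f * pieceBound f)

lemma IsIET.dense_interior_splitsVisits (hf : IsIET f) [IsProbabilityMeasure μ] (hμ : Ergodic f μ)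
    (hpos : ∀ u v, u < v → μ (Ico u v) ≠ 0) (h0 : ∀ x, μ {x} = 0) {δ : ℝ} (hδ : 0 < δ) :
    Dense (interior {t | SplitsVisits f μ (splitBound f) δ t}) := by
  rw [dense_iff_inter_open]
  rintro V hV ⟨p, hp⟩
  obtain ⟨q', hpq', hq'V⟩ := exists_Ico_subset_of_mem_nhds (hV.mem_nhds hp) (exists_gt p)
  obtain ⟨q, hpq, hqV, hqδ⟩ : ∃ q, p < q ∧ Ico p q ⊆ V ∧ (q : ℝ) - p < δ := by
    have h1 : (p : ℝ) < min (q' : ℝ) (p + δ / 2) := lt_min hpq' (by linarith)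
    refine ⟨⟨min (q' : ℝ) (p + δ / 2), p.2.1.trans h1.le, (min_le_left _ _).trans_lt q'.2.2⟩,
      h1, fun x hx => hq'V ⟨hx.1, ?_⟩, ?_⟩
    · exact (show (x : ℝ) < _ from hx.2).trans_le (min_le_left _ _)
    have := min_le_right (q' : ℝ) (p + δ / 2)
    change min (q' : ℝ) (p + δ / 2) - p < δ
    linarith
  obtain ⟨u, v, h, hJ, hJm⟩ := hf.exists_returnPiece_tower hμ hpos hpq
  obtain ⟨u', v', r, hK, hKm⟩ :=
    hf.exists_returnPiece_measure_le hμ.toMeasurePreserving hpos hJ.lt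
  obtain ⟨τ₁, τ₂, h1, h12, h2, hm₁, hm₂⟩ := exists_balanced_gap h0 hK.lt (hpos _ _ hK.lt)
  -- One factor `pieceBound f` for the choice of the column, one for the branch inside its base, and
  -- `3` for the balanced gap; none depends on `δ` or `V`.
  have hM : ∀ B, μ (Ico u' v') ≤ 3 * μ B → 1 ≤ (splitBound f : ENNReal) * (h * μ B) := by
    intro B hB
    calc (1 : ENNReal) ≤ pieceBound f * (h * (pieceBound f * (3 * μ B))) :=
          hJm.trans (by gcongr; exact hKm.trans (by gcongr))
      _ = _ := by
        rw [splitBound]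
        push_cast
        ring
  have hsub : Ioo τ₁ τ₂ ⊆ Ico u v := fun y hy =>
    hK.subset ⟨h1.trans hy.1.le, hy.2.trans_le h2⟩
  obtain ⟨τ, hτ⟩ := exists_between h12
  refine ⟨f^[h] τ, hqV (hJ.mem τ (hsub hτ)), mem_interior.2 ⟨f^[h] '' Ioo τ₁ τ₂, ?_, ?_,
    mem_image_of_mem _ hτ⟩⟩
  · rintro _ ⟨y, hy, rfl⟩
    exact hJ.splitsVisits hμ.toMeasurePreserving hK hqδ h1 h2 hy (hM _ hm₁) (hM _ hm₂)
  · refine (hJ.translation h le_rfl).isOpen_image_Ioo (u := u) (v := v) ?_ ?_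
    · exact (hK.subset (left_mem_Ico.2 hK.lt)).1.trans h1
    · by_contra hlt
      have : max u' v ∈ Ico u v := hK.subset
        ⟨le_max_left _ _, max_lt hK.lt ((not_le.1 hlt).trans_le h2)⟩
      exact absurd this.2 (not_lt.2 (le_max_right _ _))

end

/-! ### Rigid times and coboundaries. -/

/-- Density of compactly supported continuous functions in `L¹`, followed by Markov's inequality. -/
lemma exists_uniformContinuous_measure_le {α E : Type*} [PseudoMetricSpace α]
    [LocallyCompactSpace α] [MeasurableSpace α] [BorelSpace α] [NormedAddCommGroup E]
    [NormedSpace ℝ E] {μ : Measure α} [IsFiniteMeasure μ] [μ.Regular] {G : α → E}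
    (hG : AEStronglyMeasurable G μ) {C : ℝ} (hC : ∀ x, ‖G x‖ ≤ C) {ε : ℝ} (hε : 0 < ε)
    {β : ENNReal} (hβ : β ≠ 0) :
    ∃ g : α → E, UniformContinuous g ∧ μ {x | ε ≤ ‖G x - g x‖} ≤ β := by
  have hmem : MemLp G 1 μ := MemLp.of_bound hG C (.of_forall hC)
  have hε' : ENNReal.ofReal ε ≠ 0 := by simpa using hε
  obtain ⟨g, hgc, hg, hgcont, hgm⟩ := hmem.exists_hasCompactSupport_eLpNorm_sub_le
    ENNReal.one_ne_top (mul_ne_zero hε' hβ)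
  refine ⟨g, hgc.uniformContinuous_of_continuous hgcont, ?_⟩
  have h := (mul_meas_ge_le_pow_eLpNorm' μ one_ne_zero ENNReal.one_ne_top
    (hG.sub hgm.1) (ENNReal.ofReal ε)).trans (by simpa using hg)
  simp only [ENNReal.toReal_one, ENNReal.rpow_one] at h
  have h' := (ENNReal.mul_le_mul_iff_right hε' ENNReal.ofReal_ne_top).1 h
  refine (measure_mono fun x hx => ?_).trans h'
  rw [mem_ofPred_eq, Pi.sub_apply, ← ofReal_norm]
  exact ENNReal.ofReal_le_ofReal hx

lemma exists_measure_norm_le {α E : Type*} [MeasurableSpace α] [NormedAddCommGroup E]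
    [MeasurableSpace E] [BorelSpace E] {μ : Measure α} [IsFiniteMeasure μ] {G : α → E}
    (hG : Measurable G) (hG0 : ∀ᵐ x ∂μ, G x ≠ 0) {β : ENNReal} (hβ : β ≠ 0) :
    ∃ η C : ℝ, 0 < η ∧ μ {x | ¬ (η ≤ ‖G x‖ ∧ ‖G x‖ ≤ C)} ≤ β := by
  let S : ℕ → Set α := fun n => {x | ¬ ((1 : ℝ) / (n + 1) ≤ ‖G x‖ ∧ ‖G x‖ ≤ n)}
  have hSm : ∀ n, MeasurableSet (S n) := fun n =>
    ((measurableSet_le measurable_const hG.norm).inter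
      (measurableSet_le hG.norm measurable_const)).compl
  have hanti : Antitone S := by
    intro m n hmn x hx h
    refine hx ⟨le_trans ?_ h.1, h.2.trans (by exact_mod_cast hmn)⟩
    exact Nat.one_div_le_one_div hmn
  have h := tendsto_measure_iInter_atTop (fun n => (hSm n).nullMeasurableSet) hanti
    ⟨0, measure_ne_top μ _⟩
  have h0 : μ (⋂ n, S n) = 0 := by
    refine measure_mono_null (fun x hx => ?_) hG0
    intro hGx
    obtain ⟨n, hn⟩ := exists_nat_one_div_lt (norm_pos_iff.2 hGx)
    obtain ⟨m, hm⟩ := exists_nat_ge ‖G x‖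
    refine mem_iInter.1 hx (max n m) ⟨(Nat.one_div_le_one_div (le_max_left n m)).trans hn.le,
      hm.trans (by exact_mod_cast le_max_right n m)⟩
  rw [h0] at h
  obtain ⟨n, hn⟩ := (h.eventually (gt_mem_nhds (pos_iff_ne_zero.2 hβ))).exists
  exact ⟨1 / (n + 1), n, Nat.one_div_pos_of_nat, hn.le⟩

lemma ae_iterate_eq_pow_visits {α : Type*} [LinearOrder α] [MeasurableSpace α] {μ : Measure α}
    {f : α → α} (hf : Measure.QuasiMeasurePreserving f μ μ) {t : α} {θ : ℂ} {G : α → ℂ}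
    (hG : ∀ᵐ x ∂μ, G (f x) = (if x < t then θ else 1) * G x) (n : ℕ) :
    ∀ᵐ x ∂μ, G (f^[n] x) = θ ^ visits f t n x * G x := by
  induction n with
  | zero => simp [visits]
  | succ n ih =>
    filter_upwards [ih, (hf.iterate n).ae hG] with x h1 h2
    rw [Function.iterate_succ_apply', h2, h1, visits, visits, Finset.sum_range_succ, pow_add]
    split_ifs <;> ring

lemma exists_mem_of_one_le_mul_measure {α : Type*} [MeasurableSpace α] {μ : Measure α}
    {f : α → α} (hf : MeasurePreserving f μ μ) {M : ℕ} {E B N : Set α} (hE : 1 ≤ M * μ E)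
    {β : ENNReal} (hβ : M * (2 * β) < 1) (hBm : MeasurableSet B) (hB : μ B ≤ β) (hN : μ N = 0)
    (n : ℕ) : ∃ x ∈ E, x ∉ B ∧ f^[n] x ∉ B ∧ x ∉ N := by
  by_contra! h
  have hsub : E ⊆ (B ∪ f^[n] ⁻¹' B) ∪ N := by
    intro x hx
    by_cases h1 : x ∈ B
    · exact Or.inl (Or.inl h1)
    by_cases h2 : f^[n] x ∈ B
    · exact Or.inl (Or.inr h2)
    · exact Or.inr (h x hx h1 h2)
  have hle : μ E ≤ 2 * β := by
    calc μ E ≤ μ (B ∪ f^[n] ⁻¹' B) + μ N := (measure_mono hsub).trans (measure_union_le _ _)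
      _ = μ (B ∪ f^[n] ⁻¹' B) := by rw [hN, add_zero]
      _ ≤ μ B + μ (f^[n] ⁻¹' B) := measure_union_le _ _
      _ = μ B + μ B := by rw [(hf.iterate n).measure_preimage hBm.nullMeasurableSet]
      _ ≤ 2 * β := by rw [two_mul]; gcongr
  exact absurd hE (not_le.2 (lt_of_le_of_lt (by gcongr) hβ))

/-- Divide `θ ^ (s + 1) - θ ^ s` by `θ ^ s`, whose norm is at least `1 / 2`; no assumption `‖θ‖ = 1`
is needed. -/
lemma norm_sub_one_le_of_pow {θ : ℂ} {s : ℕ} {ε : ℝ} (hε : ε ≤ 1 / 2)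
    (h0 : ‖θ ^ s - 1‖ ≤ ε) (h1 : ‖θ ^ (s + 1) - 1‖ ≤ ε) : ‖θ - 1‖ ≤ 4 * ε := by
  have h2 : 1 / 2 ≤ ‖θ ^ s‖ := by
    have := norm_sub_norm_le (1 : ℂ) (1 - θ ^ s)
    rw [sub_sub_cancel, norm_one, norm_sub_rev] at this
    linarith
  have h3 : ‖θ ^ s‖ * ‖θ - 1‖ ≤ 2 * ε := by
    rw [← norm_mul, show θ ^ s * (θ - 1) = (θ ^ (s + 1) - 1) - (θ ^ s - 1) by ring]
    exact (norm_sub_le _ _).trans (by linarith)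
  nlinarith [norm_nonneg (θ - 1)]

/-- If the number of visits to `[0, t)` takes consecutive values on sets of definite measure at
arbitrarily rigid times, then the cocycle `θ ^ 1_{[0, t)}` is a coboundary only for `θ = 1`. -/
lemma eq_one_of_splitsVisits {b : ℝ} {f : Equiv.Perm (Ico (0 : ℝ) b)}
    {μ : Measure (Ico (0 : ℝ) b)} [IsProbabilityMeasure μ] (hμ : MeasurePreserving f μ μ) {M : ℕ}
    {t : Ico (0 : ℝ) b} (ht : ∀ n : ℕ, SplitsVisits f μ M (1 / (n + 1)) t)
    {θ : ℂ} {G : Ico (0 : ℝ) b → ℂ} (hG : Measurable G) (hG0 : ∀ᵐ x ∂μ, G x ≠ 0)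
    (hGf : ∀ᵐ x ∂μ, G (f x) = (if x < t then θ else 1) * G x) : θ = 1 := by
  have : LocallyCompactSpace (Ico (0 : ℝ) b) := isLocallyClosed_Ico.locallyCompactSpace
  by_contra hθ
  have hθ' : 0 < ‖θ - 1‖ := norm_pos_iff.2 (sub_ne_zero.2 hθ)
  -- Both powers will be within `3 * ε ≤ 1 / 2` of `1`, whence `‖θ - 1‖ ≤ 12 * ε ≤ ‖θ - 1‖ / 2`, a
  -- contradiction.
  let ε : ℝ := min (1 / 6) (‖θ - 1‖ / 24)
  have hε : 0 < ε := lt_min (by norm_num) (by linarith)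
  have hε1 : ε ≤ 1 / 6 := min_le_left _ _
  have hε2 : ε ≤ ‖θ - 1‖ / 24 := min_le_right _ _
  -- Two bad sets of measure at most `β` must be avoided by both `x` and `f^[r] x`, so `4 * β` has
  -- to be below `1 / M`.
  obtain ⟨β, hβ0, hβ⟩ : ∃ β : ENNReal, β ≠ 0 ∧ (M : ENNReal) * (2 * (β + β)) < 1 := by
    refine ⟨(4 * M + 1 : ENNReal)⁻¹, ENNReal.inv_ne_zero.2 (by finiteness), ?_⟩
    rw [show (M : ENNReal) * (2 * ((4 * M + 1 : ENNReal)⁻¹ + (4 * M + 1 : ENNReal)⁻¹)) =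
      4 * M / (4 * M + 1) by rw [div_eq_mul_inv]; ring]
    refine ENNReal.div_lt_of_lt_mul ?_
    rw [one_mul]
    exact ENNReal.lt_add_right (by finiteness) one_ne_zero
  obtain ⟨η, C, hη, hηC⟩ := exists_measure_norm_le hG hG0 hβ0
  set B₁ := {x | ¬ (η ≤ ‖G x‖ ∧ ‖G x‖ ≤ C)} with hB₁
  have hB₁m : MeasurableSet B₁ := ((measurableSet_le measurable_const hG.norm).inter
      (measurableSet_le hG.norm measurable_const)).compl
  have hbound : ∀ x, ‖B₁ᶜ.indicator G x‖ ≤ |C| := by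
    intro x
    by_cases hx : x ∈ B₁ᶜ
    · rw [indicator_of_mem hx]
      exact (not_not.1 hx).2.trans (le_abs_self C)
    · rw [indicator_of_notMem hx, norm_zero]
      exact abs_nonneg C
  obtain ⟨g, hg, hgβ⟩ := exists_uniformContinuous_measure_le (μ := μ)
    (hG.indicator hB₁m.compl).aestronglyMeasurable hbound (mul_pos hε hη) hβ0
  set B₂ := {x | ε * η ≤ ‖B₁ᶜ.indicator G x - g x‖} with hB₂
  have hB₂m : MeasurableSet B₂ := measurableSet_le measurable_const
    ((hG.indicator hB₁m.compl).sub hg.continuous.measurable).norm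
  have hBβ : μ (B₁ ∪ B₂) ≤ β + β := (measure_union_le _ _).trans (add_le_add hηC hgβ)
  -- Here `δ` is chosen after `g`, and `g` depends on `M`; hence `M` must not depend on `δ`.
  obtain ⟨δ, hδ, hgδ⟩ := Metric.uniformContinuous_iff.1 hg _ (mul_pos hε hη)
  obtain ⟨n, hn⟩ := exists_nat_one_div_lt hδ
  obtain ⟨r, s, hrs⟩ := ht n
  have hae := ae_iterate_eq_pow_visits hμ.quasiMeasurePreserving hGf r
  have key : ∀ e < 2, ‖θ ^ (s + e) - 1‖ ≤ 3 * ε := by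
    intro e he
    obtain ⟨E, hE, hEx⟩ := hrs e he
    obtain ⟨x, hxE, hx, hfx, hxN⟩ := exists_mem_of_one_le_mul_measure hμ hE hβ
      (hB₁m.union hB₂m) hBβ (ae_iff.1 hae) r
    obtain ⟨hclose, hvis⟩ := hEx x hxE
    have hGx : G (f^[r] x) = θ ^ (s + e) * G x := by
      rw [← hvis]
      exact not_not.1 hxN
    have happ : ∀ y, y ∉ B₁ ∪ B₂ → ‖G y - g y‖ < ε * η := by
      intro y hy
      rw [mem_union, not_or] at hy
      have := not_le.1 (show ¬ ε * η ≤ ‖B₁ᶜ.indicator G y - g y‖ from hy.2)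
      rwa [indicator_of_mem (mem_compl hy.1)] at this
    have hη' : η ≤ ‖G x‖ := by
      rw [mem_union, not_or] at hx
      exact (not_not.1 hx.1).1
    have h1 := happ x hx
    have h2 := happ _ hfx
    have h3 : ‖g (f^[r] x) - g x‖ < ε * η := by
      rw [← dist_eq_norm]
      refine hgδ ?_
      rw [Subtype.dist_eq, Real.dist_eq]
      exact hclose.trans hn
    have h4 : ‖θ ^ (s + e) - 1‖ * ‖G x‖ ≤ 3 * (ε * η) := by
      rw [← norm_mul, sub_mul, one_mul, ← hGx, show G (f^[r] x) - G x =
        (G (f^[r] x) - g (f^[r] x)) + (g (f^[r] x) - g x) - (G x - g x) by ring]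
      refine (norm_sub_le _ _).trans ((add_le_add_left (norm_add_le _ _) _).trans ?_)
      linarith
    have h5 : ‖θ ^ (s + e) - 1‖ * η ≤ 3 * ε * η := by
      nlinarith [norm_nonneg (θ ^ (s + e) - 1)]
    exact le_of_mul_le_mul_right h5 hη
  have := norm_sub_one_le_of_pow (by linarith) (key 0 (by norm_num)) (key 1 (by norm_num))
  linarith

/-! ### Induced maps: measurability, invariance, ergodicity, eigenfunctions. -/

section

variable {α : Type*}

/-- The orbit of `x` returns to `A` at time `n` for the first time. -/
structure IsFirstReturn (f : α → α) (A : Set α) (x : α) (n : ℕ) : Prop where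
  pos : 0 < n
  mem : f^[n] x ∈ A
  notMem : ∀ m, 0 < m → m < n → f^[m] x ∉ A

lemma IsFirstReturn.coe_inducedMap {f : α → α} {A : Set α} {x : A} {n : ℕ}
    (h : IsFirstReturn f A x n) : (inducedMap f A x : α) = f^[n] x := by
  classical
  have hex : ∃ n : ℕ, 0 < n ∧ f^[n] (x : α) ∈ A := ⟨n, h.pos, h.mem⟩
  have hfind : Nat.find hex = n :=
    (Nat.find_eq_iff hex).2 ⟨⟨h.pos, h.mem⟩, fun m hm hm' => h.notMem m hm'.1 hm hm'.2⟩
  rw [inducedMap, dif_pos hex]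
  exact congrArg (fun k => f^[k] (x : α)) hfind

lemma exists_isFirstReturn {f : α → α} {A : Set α} {x : α} (h : ∃ n, 0 < n ∧ f^[n] x ∈ A) :
    ∃ n, IsFirstReturn f A x n := by
  classical
  exact ⟨Nat.find h, (Nat.find_spec h).1, (Nat.find_spec h).2,
    fun m hm hmn hmA => Nat.find_min h hmn ⟨hm, hmA⟩⟩

lemma inducedMap_of_forall_notMem {f : α → α} {A : Set α} {x : A}
    (h : ¬ ∃ n, 0 < n ∧ f^[n] (x : α) ∈ A) : inducedMap f A x = x := by
  rw [inducedMap, dif_neg h]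

variable [MeasurableSpace α] {f : α → α} {A : Set α} {μ : Measure α}

lemma measurableSet_isFirstReturn (hf : Measurable f) (hA : MeasurableSet A) (n : ℕ) :
    MeasurableSet {x | IsFirstReturn f A x n} := by
  have : {x | IsFirstReturn f A x n} = {x | 0 < n} ∩ (f^[n] ⁻¹' A ∩
      ⋂ m, ⋂ (_ : 0 < m), ⋂ (_ : m < n), (f^[m] ⁻¹' A)ᶜ) := by
    ext x
    refine ⟨fun h => ⟨h.pos, h.mem, ?_⟩, fun h => ⟨h.1, h.2.1, ?_⟩⟩
    · exact mem_iInter.2 fun m => mem_iInter.2 fun h1 => mem_iInter.2 fun h2 => h.notMem m h1 h2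
    · exact fun m h1 h2 => mem_iInter.1 (mem_iInter.1 (mem_iInter.1 h.2.2 m) h1) h2
  rw [this]
  refine (MeasurableSet.const _).inter (((hf.iterate n) hA).inter ?_)
  exact .iInter fun m => .iInter fun _ => .iInter fun _ => ((hf.iterate m) hA).compl

lemma measurable_inducedMap (hf : Measurable f) (hA : MeasurableSet A) :
    Measurable (inducedMap f A) := by
  refine Measurable.subtype_mk (p := (· ∈ A)) (f := fun x => (inducedMap f A x : α)) ?_
    (h := fun x => (inducedMap f A x).2)
  intro S hS
  have hret : ∀ n, MeasurableSet {x : A | IsFirstReturn f A x n} := fun n =>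
    measurable_subtype_coe (measurableSet_isFirstReturn hf hA n)
  have : (fun x => (inducedMap f A x : α)) ⁻¹' S =
      ((⋃ n, {x : A | IsFirstReturn f A x n})ᶜ ∩ Subtype.val ⁻¹' S) ∪
      ⋃ n, ({x : A | IsFirstReturn f A x n} ∩ Subtype.val ⁻¹' (f^[n] ⁻¹' S)) := by
    ext x
    by_cases hx : ∃ n, 0 < n ∧ f^[n] (x : α) ∈ A
    · obtain ⟨n, hn⟩ := exists_isFirstReturn hx
      constructor
      · intro h
        refine Or.inr (mem_iUnion.2 ⟨n, hn, ?_⟩)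
        rwa [mem_preimage, hn.coe_inducedMap] at h
      · rintro (h | h)
        · exact absurd (mem_iUnion.2 ⟨n, hn⟩) h.1
        · obtain ⟨m, hm, h⟩ := mem_iUnion.1 h
          rw [mem_preimage, IsFirstReturn.coe_inducedMap hm]
          exact h
    · have hx' : ∀ n, ¬ IsFirstReturn f A x n := fun n hn => hx ⟨n, hn.pos, hn.mem⟩
      rw [mem_preimage, inducedMap_of_forall_notMem hx]
      constructor
      · refine fun h => Or.inl ⟨fun hu => ?_, h⟩
        obtain ⟨n, hn⟩ := mem_iUnion.1 hu
        exact hx' n hn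
      · rintro (h | h)
        · exact h.2
        · obtain ⟨n, hn, -⟩ := mem_iUnion.1 h
          exact absurd hn (hx' n)
  rw [this]
  exact ((MeasurableSet.iUnion hret).compl.inter (measurable_subtype_coe hS)).union
    (.iUnion fun n => (hret n).inter (measurable_subtype_coe ((hf.iterate n) hS)))

lemma Ergodic.ae_exists_iterate_mem [IsFiniteMeasure μ] (hf : Ergodic f μ) (hA : MeasurableSet A)
    (hA0 : μ A ≠ 0) : ∀ᵐ x ∂μ, ∃ n, f^[n] x ∈ A := by
  have hUm : MeasurableSet (⋃ n, f^[n] ⁻¹' A) :=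
    .iUnion fun n => (hf.measurable.iterate n) hA
  have hsub : f ⁻¹' (⋃ n, f^[n] ⁻¹' A) ⊆ ⋃ n, f^[n] ⁻¹' A := by
    intro x hx
    obtain ⟨n, hn⟩ := mem_iUnion.1 hx
    exact mem_iUnion.2 ⟨n + 1, hn⟩
  rcases hf.ae_empty_or_univ_of_preimage_ae_le hUm.nullMeasurableSet hsub.eventuallyLE with h | h
  · refine absurd (measure_mono_null (subset_iUnion (fun n => f^[n] ⁻¹' A) 0) ?_) hA0
    rw [measure_congr h, measure_empty]
  · filter_upwards [h.mem_iff] with x hx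
    exact mem_iUnion.1 (hx.2 (mem_univ x))

lemma Ergodic.ae_exists_isFirstReturn [IsFiniteMeasure μ] (hf : Ergodic f μ)
    (hA : MeasurableSet A) (hA0 : μ A ≠ 0) : ∀ᵐ x ∂μ, ∃ n, IsFirstReturn f A x n := by
  filter_upwards [hf.quasiMeasurePreserving.ae (hf.ae_exists_iterate_mem hA hA0)] with x hx
  obtain ⟨n, hn⟩ := hx
  exact exists_isFirstReturn ⟨n + 1, n.succ_pos, hn⟩

lemma ae_comap_subtype_iff (hA : MeasurableSet A) {p : α → Prop} :
    (∀ᵐ x : A ∂μ.comap (Subtype.val : A → α), p x) ↔ ∀ᵐ x ∂μ, x ∈ A → p x := by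
  rw [← ae_restrict_iff' hA, ← map_comap_subtype_coe hA μ,
    (MeasurableEmbedding.subtype_coe hA).ae_map_iff]

lemma ae_inducedMeasure_iff [IsFiniteMeasure μ] {p : A → Prop} :
    (∀ᵐ x ∂inducedMeasure μ A, p x) ↔ ∀ᵐ x : A ∂μ.comap (Subtype.val : A → α), p x := by
  rw [inducedMeasure,
    Measure.ae_ennreal_smul_measure_iff (ENNReal.inv_ne_zero.2 (measure_ne_top μ A))]

lemma isProbabilityMeasure_inducedMeasure [IsFiniteMeasure μ] (hA : MeasurableSet A)
    (hA0 : μ A ≠ 0) : IsProbabilityMeasure (inducedMeasure μ A) := by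
  constructor
  rw [inducedMeasure, Measure.smul_apply, comap_subtype_coe_apply hA, image_univ,
    Subtype.range_coe, smul_eq_mul, ENNReal.inv_mul_cancel hA0 (measure_ne_top μ A)]

/-- The extension of a function on `A` along the first entry map to `A`. -/
lemma exists_extension_of_comp_inducedMap [IsFiniteMeasure μ] (hf : Ergodic f μ)
    (hA : MeasurableSet A) (hA0 : μ A ≠ 0) {θ : ℂ} {g : A → ℂ} (hg : Measurable g)
    (hgf : ∀ᵐ x ∂μ.comap (Subtype.val : A → α), g (inducedMap f A x) = θ * g x) :
    ∃ G : α → ℂ, Measurable G ∧ (∀ x : A, G x = g x) ∧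
      (∀ᵐ x ∂μ, x ∈ A → G (f x) = θ * G x) ∧ ∀ᵐ x ∂μ, x ∉ A → G (f x) = G x := by
  classical
  let g₀ : α → ℂ := Function.extend Subtype.val g 0
  have hg₀ : Measurable g₀ :=
    (MeasurableEmbedding.subtype_coe hA).measurable_extend hg measurable_const
  have hg₀A : ∀ x : A, g₀ x = g x := fun x => Subtype.val_injective.extend_apply g 0 x
  -- The second alternative makes the entry time total; it only concerns a null set.
  let p : ℕ → α → Prop := fun n x => f^[n] x ∈ A ∨ ∀ m, f^[m] x ∉ A
  have hp : ∀ x, ∃ n, p n x := by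
    intro x
    by_cases h : ∃ n, f^[n] x ∈ A
    · exact h.imp fun n hn => Or.inl hn
    · exact ⟨0, Or.inr (not_exists.1 h)⟩
  have hpm : ∀ n, MeasurableSet {x | p n x} := by
    intro n
    refine ((hf.measurable.iterate n) hA).union (?_ : MeasurableSet {x | ∀ m, f^[m] x ∉ A})
    rw [ofPred_forall]
    exact .iInter fun m => ((hf.measurable.iterate m) hA).compl
  let G : α → ℂ := fun x => g₀ (f^[Nat.find (hp x)] x)
  have hG : Measurable G := hg₀.comp (Measurable.find hf.measurable.iterate hpm hp)
  have hGn : ∀ n x, f^[n] x ∈ A → (∀ m < n, f^[m] x ∉ A) → G x = g₀ (f^[n] x) := by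
    intro n x hn hlt
    have : Nat.find (hp x) = n := (Nat.find_eq_iff (hp x)).2
      ⟨Or.inl hn, fun m hm h => h.elim (hlt m hm) fun h => h n hn⟩
    simp only [G, this]
  have hGA : ∀ x : A, G x = g x := fun x =>
    (hGn 0 x x.2 fun m hm => absurd hm m.not_lt_zero).trans (hg₀A x)
  have hGf : ∀ n x, IsFirstReturn f A x n → G (f x) = g₀ (f^[n] x) := by
    intro n x hn
    obtain ⟨k, rfl⟩ := Nat.exists_eq_add_of_le' hn.pos
    exact hGn k (f x) hn.mem fun m hm => hn.notMem (m + 1) m.succ_pos (by omega)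
  have hret := hf.ae_exists_isFirstReturn hA hA0
  refine ⟨G, hG, hGA, ?_, ?_⟩
  · have h1 : ∀ᵐ x : A ∂μ.comap (Subtype.val : A → α), G (f x) = θ * G x := by
      filter_upwards [hgf, (ae_comap_subtype_iff hA).2 (hret.mono fun x h _ => h)] with x hx hr
      obtain ⟨n, hn⟩ := hr
      rw [hGf n x hn, ← hn.coe_inducedMap, hg₀A, hx, hGA]
    exact (ae_comap_subtype_iff hA).1 h1
  · filter_upwards [hret] with x ⟨n, hn⟩ hxA
    rw [hGf n x hn, hGn n x hn.mem]
    intro m hm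
    rcases Nat.eq_zero_or_pos m with rfl | hpos
    · exact hxA
    · exact hn.notMem m hpos hm

end

section

variable {α : Type*} [MeasurableSpace α] [StandardBorelSpace α] {f : Equiv.Perm α} {A : Set α}
  {μ : Measure α}

/-- Split the preimage by return time `n`. The images under `f^[n]` keep their mass, lie in `S`, and
are disjoint because the return is the first one. The inequality suffices for invariance, since the
total masses agree. -/
lemma comap_preimage_inducedMap_le [IsFiniteMeasure μ] (hf : Ergodic f μ) (hA : MeasurableSet A)
    (hA0 : μ A ≠ 0) {S : Set A} (hS : MeasurableSet S) :
    μ.comap (Subtype.val : A → α) (inducedMap f A ⁻¹' S) ≤ μ.comap (Subtype.val : A → α) S := by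
  have hS' : MeasurableSet ((↑) '' S : Set α) := hA.subtype_image hS
  rw [comap_subtype_coe_apply hA, comap_subtype_coe_apply hA]
  let W : ℕ → Set α := fun n => {x | IsFirstReturn f A x n} ∩ (A ∩ f^[n] ⁻¹' ((↑) '' S))
  have hW : ∀ n, MeasurableSet (W n) := fun n =>
    (measurableSet_isFirstReturn hf.measurable hA n).inter
      (hA.inter ((hf.measurable.iterate n) hS'))
  have key : ∀ m n, m < n → ∀ x ∈ W m, ∀ y ∈ W n, f^[m] x ≠ f^[n] y := by
    intro m n hmn x hx y hy h
    obtain ⟨k, rfl⟩ := Nat.exists_eq_add_of_lt hmn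
    rw [add_assoc, Function.iterate_add_apply] at h
    have := f.injective.iterate m h
    exact IsFirstReturn.notMem hy.1 (k + 1) k.succ_pos (by have := hx.1.pos; omega)
      (this ▸ hx.2.1)
  calc μ ((↑) '' (inducedMap f A ⁻¹' S)) ≤ μ (⋃ n, W n) := by
        refine measure_mono_ae ?_
        filter_upwards [hf.ae_exists_isFirstReturn hA hA0] with x ⟨n, hn⟩ hx
        obtain ⟨x, hxS, rfl⟩ := hx
        refine mem_iUnion.2 ⟨n, hn, x.2, ?_⟩
        rw [mem_preimage, ← hn.coe_inducedMap]
        exact mem_image_of_mem _ hxS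
    _ ≤ ∑' n, μ (W n) := measure_iUnion_le _
    _ = ∑' n, μ (f^[n] '' W n) := by
        congr with n
        rw [hf.toMeasurePreserving.measure_image_iterate n (hW n)]
    _ = μ (⋃ n, f^[n] '' W n) := by
        refine (measure_iUnion (fun m n hmn => disjoint_left.2 ?_) fun n =>
          (Equiv.Perm.measurableEmbedding_iterate hf.measurable n).measurableSet_image.2
            (hW n)).symm
        rintro _ ⟨x, hx, rfl⟩ ⟨y, hy, hxy⟩
        rcases lt_or_gt_of_ne hmn with h | h
        · exact key m n h x hx y hy hxy.symm
        · exact key n m h y hy x hx hxy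
    _ ≤ μ ((↑) '' S) := by
        refine measure_mono (iUnion_subset fun n => ?_)
        rintro _ ⟨x, hx, rfl⟩
        exact hx.2.2

lemma measurePreserving_inducedMap [IsFiniteMeasure μ] (hf : Ergodic f μ) (hA : MeasurableSet A)
    (hA0 : μ A ≠ 0) :
    MeasurePreserving (inducedMap f A) (inducedMeasure μ A) (inducedMeasure μ A) := by
  have hT := measurable_inducedMap hf.measurable hA
  have : IsFiniteMeasure (μ.comap (Subtype.val : A → α)) :=
    ⟨by rw [comap_subtype_coe_apply hA]; exact measure_lt_top _ _⟩
  have : MeasurePreserving (inducedMap f A) (μ.comap (Subtype.val : A → α))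
      (μ.comap (Subtype.val : A → α)) := by
    refine ⟨hT, Measure.eq_of_le_of_measure_univ_eq (Measure.le_iff.2 fun S hS => ?_) ?_⟩
    · rw [Measure.map_apply hT hS]
      exact comap_preimage_inducedMap_le hf hA hA0 hS
    · rw [Measure.map_apply hT .univ, preimage_univ]
  exact this.smul_measure _

lemma ergodic_inducedMap [IsFiniteMeasure μ] (hf : Ergodic f μ) (hA : MeasurableSet A)
    (hA0 : μ A ≠ 0) : Ergodic (inducedMap f A) (inducedMeasure μ A) := by
  refine ⟨measurePreserving_inducedMap hf hA hA0, ⟨fun s hs hfs => ?_⟩⟩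
  classical
  obtain ⟨G, hG, hGs, h1, h2⟩ := exists_extension_of_comp_inducedMap hf hA hA0 (θ := 1)
    (g := s.indicator 1) (measurable_one.indicator hs) (.of_forall fun x => by
      have : inducedMap f A x ∈ s ↔ x ∈ s := by rw [← mem_preimage, hfs]
      simp only [indicator_apply, this, one_mul, Pi.one_apply])
  obtain ⟨c, hc⟩ := hf.ae_eq_const_of_ae_eq_comp_ae hG.aestronglyMeasurable (by
    filter_upwards [h1, h2] with x h1 h2
    by_cases hx : x ∈ A
    · simpa using h1 hx
    · exact h2 hx)
  have hc' : ∀ᵐ x ∂inducedMeasure μ A, s.indicator 1 x = c := by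
    rw [ae_inducedMeasure_iff]
    filter_upwards [(ae_comap_subtype_iff hA).2 (hc.mono fun x h _ => h)] with x hx
    rw [← hGs, hx, Function.const_apply]
  rw [eventuallyConst_set']
  by_cases h : c = 1
  · right
    filter_upwards [hc'] with x hx
    rw [h] at hx
    have : x ∈ s := by
      by_contra hxs
      rw [indicator_of_notMem hxs] at hx
      exact zero_ne_one hx
    exact propext ⟨fun _ => trivial, fun _ => this⟩
  · left
    filter_upwards [hc'] with x hx
    have : x ∉ s := by
      intro hxs
      rw [indicator_of_mem hxs] at hx
      exact h hx.symm
    exact propext ⟨fun h => this h, fun h => h.elim⟩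

/-- An induced map is weakly mixing if the cocycle `θ ^ 1_A` is a nonvanishing coboundary only for
`θ = 1`. -/
lemma isWeaklyMixing_inducedMap [IsFiniteMeasure μ] (hf : Ergodic f μ) (hA : MeasurableSet A)
    (hA0 : μ A ≠ 0) (H : ∀ (θ : ℂ) (G : α → ℂ), Measurable G → (∀ᵐ x ∂μ, G x ≠ 0) →
      (∀ᵐ x ∂μ, x ∈ A → G (f x) = θ * G x) → (∀ᵐ x ∂μ, x ∉ A → G (f x) = G x) → θ = 1) :
    IsWeaklyMixing (inducedMap f A) (inducedMeasure μ A) := by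
  refine ⟨isProbabilityMeasure_inducedMeasure hA hA0, ergodic_inducedMap hf hA hA0,
    fun θ g hg hgθ => ?_⟩
  rw [ae_inducedMeasure_iff] at hgθ
  simp_rw [ae_inducedMeasure_iff]
  obtain ⟨G, hG, hGg, h1, h2⟩ := exists_extension_of_comp_inducedMap hf hA hA0 hg hgθ
  have hconst : ∀ c, (∀ᵐ x ∂μ, G x = c) → ∀ᵐ x ∂μ.comap (Subtype.val : A → α), g x = c := by
    intro c hc
    filter_upwards [(ae_comap_subtype_iff hA).2 (hc.mono fun x h _ => h)] with x hx
    rw [← hGg, hx]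
  have hZ : MeasurableSet (G ⁻¹' {0}) := hG (measurableSet_singleton 0)
  -- The zero set of `G` is mapped into itself, so it is null or of full measure; the latter case
  -- covers `g = 0` and with it `θ = 0`.
  rcases hf.ae_empty_or_univ_of_ae_le_preimage hZ.nullMeasurableSet (by
    filter_upwards [h1, h2] with x h1 h2 hx
    have hx : G x = 0 := hx
    change G (f x) = 0
    by_cases hxA : x ∈ A
    · rw [h1 hxA, hx, mul_zero]
    · rw [h2 hxA, hx]) with hZ0 | hZ1
  · obtain rfl := H θ G hG (hZ0.mem_iff.mono fun x hx h => hx.1 h) h1 h2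
    obtain ⟨c, hc⟩ := hf.ae_eq_const_of_ae_eq_comp_ae hG.aestronglyMeasurable (by
      filter_upwards [h1, h2] with x h1 h2
      by_cases hx : x ∈ A
      · simpa using h1 hx
      · exact h2 hx)
    exact ⟨c, hconst c hc⟩
  · exact ⟨0, hconst 0 (hZ1.mem_iff.mono fun x hx => hx.2 (mem_univ x))⟩

end

/-! ### Finiteness of the set of ergodic measures. -/

/-- The part of `μ` absolutely continuous with respect to `ν` is invariant, hence a multiple of both
measures, with the same factor. If the factor is zero, `μ` equals its singular part; otherwise `μ =
ν`. -/
lemma Ergodic.mutuallySingular_of_ne {α : Type*} [MeasurableSpace α] {f : α → α}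
    {μ ν : Measure α} [IsProbabilityMeasure μ] [IsProbabilityMeasure ν] (hμ : Ergodic f μ)
    (hν : Ergodic f ν) (hne : μ ≠ ν) : μ ⟂ₘ ν := by
  have hρ := hμ.toMeasurePreserving.withDensity_rnDeriv hν.toMeasurePreserving
  have hle := Measure.withDensity_rnDeriv_le μ ν
  have : IsFiniteMeasure (ν.withDensity (μ.rnDeriv ν)) := isFiniteMeasure_of_le μ hle
  obtain ⟨c, hc⟩ := hν.eq_smul_of_absolutelyContinuous hρ (withDensity_absolutelyContinuous _ _)
  obtain ⟨c', hc'⟩ := hμ.eq_smul_of_absolutelyContinuous hρ hle.absolutelyContinuous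
  have hcc : c = c' := by
    have := congrArg (fun m : Measure α => m univ) (hc.symm.trans hc')
    simpa using this
  by_cases h0 : c = 0
  · rw [h0, zero_smul] at hc
    have hadd := Measure.haveLebesgueDecomposition_add μ ν
    have hsing := Measure.mutuallySingular_singularPart μ ν
    rw [hc, add_zero] at hadd
    rwa [← hadd] at hsing
  · refine absurd (Measure.ext fun s _ => ?_) hne
    have h := congrArg (fun m : Measure α => m s) (hc'.symm.trans hc)
    subst hcc
    have hctop : c ≠ ⊤ := by
      intro htop
      have := congrArg (fun m : Measure α => m univ) hc
      simp only [htop, Measure.smul_apply, measure_univ, smul_eq_mul, mul_one] at this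
      exact measure_ne_top _ _ this
    exact (ENNReal.mul_right_inj h0 hctop).1 h

/-- The positive and negative parts of the combination agree on a generating π-system, hence
everywhere. If `a i₀ > 0`, then `μ i₀` is absolutely continuous with respect to the negative part,
to which it is singular. -/
lemma nonpos_of_measure_relation {α ι : Type*} [MeasurableSpace α] [Fintype ι]
    {C : Set (Set α)} (hgen : ‹MeasurableSpace α› = MeasurableSpace.generateFrom C)
    (hC : IsPiSystem C) {μ : ι → Measure α} [∀ i, IsProbabilityMeasure (μ i)]
    (hsing : ∀ i j, i ≠ j → μ i ⟂ₘ μ j) {a : ι → ℝ}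
    (huniv : ∑ i, a i * (μ i).real univ = 0) (hrel : ∀ S ∈ C, ∑ i, a i * (μ i).real S = 0)
    (i₀ : ι) : a i₀ ≤ 0 := by
  classical
  by_contra! hpos
  let P : (ι → ℝ) → Measure α := fun a => ∑ i, ENNReal.ofReal (a i) • μ i
  have hfin : ∀ a, IsFiniteMeasure (P a) := fun a => by
    refine ⟨?_⟩
    simp only [P, Measure.coe_finsetSum, Finset.sum_apply, Measure.smul_apply, smul_eq_mul]
    exact ENNReal.sum_lt_top.2 fun i _ => ENNReal.mul_lt_top ENNReal.ofReal_lt_top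
      (measure_lt_top _ _)
  have happ : ∀ a S, (P a).real S = ∑ i, max (a i) 0 * (μ i).real S := by
    intro a S
    rw [measureReal_def]
    simp only [P, Measure.coe_finsetSum, Finset.sum_apply, Measure.smul_apply, smul_eq_mul]
    rw [ENNReal.toReal_sum fun i _ => ENNReal.mul_ne_top ENNReal.ofReal_ne_top
      (measure_ne_top _ _)]
    refine Finset.sum_congr rfl fun i _ => ?_
    rw [ENNReal.toReal_mul, ENNReal.toReal_ofReal']
    rfl
  have heq : ∀ S, ∑ i, a i * (μ i).real S = 0 → P a S = P (-a) S := by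
    intro S hS
    rw [← measureReal_eq_measureReal_iff, happ, happ, ← sub_eq_zero, ← Finset.sum_sub_distrib]
    refine Eq.trans (Finset.sum_congr rfl fun i _ => ?_) hS
    rw [← sub_mul, Pi.neg_apply]
    congr 1
    rcases le_total (a i) 0 with h | h
    · rw [max_eq_right h, max_eq_left (by linarith)]; ring
    · rw [max_eq_left h, max_eq_right (by linarith)]; ring
  have hP : P a = P (-a) :=
    ext_of_generate_finite C hgen hC (fun S hS => heq S (hrel S hS)) (heq _ huniv)
  have hac : μ i₀ ≪ P (-a) := by
    rw [← hP]
    refine Measure.AbsolutelyContinuous.mk fun s _ hs => ?_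
    simp only [P, Measure.coe_finsetSum, Finset.sum_apply, Measure.smul_apply, smul_eq_mul] at hs
    have := (Finset.sum_eq_zero_iff.1 hs) i₀ (Finset.mem_univ _)
    exact (mul_eq_zero.1 this).resolve_left (by simpa using hpos)
  have hms : ∀ T : Finset ι, μ i₀ ⟂ₘ ∑ i ∈ T, ENNReal.ofReal (-a i) • μ i := by
    intro T
    induction T using Finset.induction_on with
    | empty => simp
    | insert j T hj ih =>
      rw [Finset.sum_insert hj]
      refine Measure.MutuallySingular.add_right ?_ ih
      by_cases h : i₀ = j
      · subst h
        rw [ENNReal.ofReal_of_nonpos (by linarith), zero_smul]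
        exact Measure.MutuallySingular.zero_right
      · exact ((hsing _ _ h).symm.smul _).symm
  have h0 := Measure.eq_zero_of_absolutelyContinuous_of_mutuallySingular hac (hms Finset.univ)
  exact IsProbabilityMeasure.ne_zero (μ i₀) h0

section

variable {b : ℝ} {f : Equiv.Perm (Ico (0 : ℝ) b)}

open Classical in
/-- The number of points of `D` up to `x`. -/
noncomputable def countLE {α : Type*} [LinearOrder α] (D : Finset α) (x : α) : Fin (D.card + 1) :=
  ⟨(D.filter (· ≤ x)).card, Nat.lt_succ_of_le (Finset.card_filter_le _ _)⟩

lemma countLE_monotone {α : Type*} [LinearOrder α] (D : Finset α) : Monotone (countLE D) := by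
  classical
  intro x y hxy
  exact Finset.card_le_card fun z hz => by
    rw [Finset.mem_filter] at hz ⊢
    exact ⟨hz.1, hz.2.trans hxy⟩

lemma notMem_of_countLE_eq {α : Type*} [LinearOrder α] {D : Finset α} {x y : α}
    (h : countLE D x = countLE D y) {d : α} (hd : d ∈ Ioc x y) : d ∉ D := by
  classical
  intro hdD
  refine absurd (congrArg Fin.val h) (ne_of_lt (Finset.card_lt_card ?_))
  refine Finset.ssubset_iff_of_subset (fun z hz => ?_) |>.2 ⟨d, ?_, ?_⟩
  · rw [Finset.mem_filter] at hz ⊢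
    exact ⟨hz.1, hz.2.trans (hd.1.le.trans hd.2)⟩
  · exact Finset.mem_filter.2 ⟨hdD, hd.2⟩
  · exact fun h => absurd (Finset.mem_filter.1 h).2 (not_le.2 hd.1)

lemma ordConnected_countLE {α : Type*} [LinearOrder α] (D : Finset α) (k : Fin (D.card + 1)) :
    (countLE D ⁻¹' {k}).OrdConnected :=
  ordConnected_singleton.preimage_mono (countLE_monotone D)

lemma IsIET.isTranslationOn_countLE (hf : IsIET f) {D : Finset (Ico (0 : ℝ) b)}
    (hD : ∀ x, x ∉ D → ContinuousAt f x) (k : Fin (D.card + 1)) :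
    IsTranslationOn f (countLE D ⁻¹' {k}) := by
  have key : ∀ x ∈ countLE D ⁻¹' {k}, ∀ y ∈ countLE D ⁻¹' {k}, x < y →
      (f y : ℝ) - f x = (y : ℝ) - x := fun x hx y hy hxy =>
    hf.sub_eq hxy fun d hd => hD d (notMem_of_countLE_eq (Eq.trans hx (Eq.symm hy)) hd)
  intro x hx y hy
  rcases lt_trichotomy x y with h | rfl | h
  · linarith [key x hx y hy h]
  · simp
  · exact key y hy x hx h

lemma sum_measureReal_eq_of_fiber {α ι κ : Type*} [MeasurableSpace α] [Fintype ι] [Fintype κ]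
    [DecidableEq κ] {μ : ι → Measure α} [∀ i, IsFiniteMeasure (μ i)] {φ : α → κ}
    (hφ : ∀ k, MeasurableSet (φ ⁻¹' {k})) {a : ι → ℝ}
    (ha : ∀ k, ∑ i, a i * (μ i).real (φ ⁻¹' {k}) = 0) {S : Set α} (hS : MeasurableSet S)
    {k₀ : κ} (hk : ∀ k ≠ k₀, ∀ x y, φ x = k → φ y = k → x ∈ S → y ∈ S) :
    ∑ i, a i * (μ i).real S = ∑ i, a i * (μ i).real (φ ⁻¹' {k₀} ∩ S) := by
  have hsum : ∀ i, (μ i).real S = ∑ k, (μ i).real (φ ⁻¹' {k} ∩ S) := by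
    intro i
    rw [← measureReal_biUnion_finset]
    · congr 1
      ext x
      simp
    · intro k _ k' _ hkk
      exact disjoint_left.2 fun x hx hx' => hkk (hx.1.symm.trans hx'.1)
    · exact fun k _ => (hφ k).inter hS
  simp_rw [hsum, Finset.mul_sum]
  rw [Finset.sum_comm, Finset.sum_eq_single k₀]
  · intro k _ hkk
    by_cases hne : (φ ⁻¹' {k} ∩ S).Nonempty
    · obtain ⟨x, hx, hxS⟩ := hne
      have : φ ⁻¹' {k} ∩ S = φ ⁻¹' {k} := inter_eq_left.2 fun y hy => hk k hkk x y hx hy hxS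
      rw [this]
      exact ha k
    · rw [not_nonempty_iff_eq_empty.1 hne]
      simp
  · exact fun h => absurd (Finset.mem_univ _) h

lemma sum_measureReal_univ_eq_zero {α ι κ : Type*} [MeasurableSpace α] [Fintype ι] [Fintype κ]
    [DecidableEq κ] {μ : ι → Measure α} [∀ i, IsFiniteMeasure (μ i)] {φ : α → κ}
    (hφ : ∀ k, MeasurableSet (φ ⁻¹' {k})) {a : ι → ℝ}
    (ha : ∀ k, ∑ i, a i * (μ i).real (φ ⁻¹' {k}) = 0) (k₀ : κ) :
    ∑ i, a i * (μ i).real univ = 0 := by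
  rw [sum_measureReal_eq_of_fiber hφ ha .univ (k₀ := k₀) fun _ _ _ _ _ _ _ => mem_univ _]
  simpa using ha k₀

/-- A linear relation between the masses given by invariant measures to the intervals of continuity
extends to all initial intervals. -/
lemma IsIET.sum_measureReal_Iio_eq_zero (hb : 0 < b) (hf : IsIET f) (hmin : IsMinimalPerm f)
    {ι : Type*} [Fintype ι] {μ : ι → Measure (Ico (0 : ℝ) b)} [∀ i, IsFiniteMeasure (μ i)]
    (hμ : ∀ i, MeasurePreserving f (μ i) (μ i)) (h0 : ∀ i x, μ i {x} = 0)
    {D : Finset (Ico (0 : ℝ) b)} (hD : ∀ x, x ∉ D → ContinuousAt f x) {a : ι → ℝ}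
    (ha : ∀ k, ∑ i, a i * (μ i).real (countLE D ⁻¹' {k}) = 0) (x : Ico (0 : ℝ) b) :
    ∑ i, a i * (μ i).real (Iio x) = 0 := by
  classical
  let F : Ico (0 : ℝ) b → ℝ := fun x => ∑ i, a i * (μ i).real (Iio x)
  have hm : ∀ k, MeasurableSet (countLE D ⁻¹' {k}) := fun k =>
    (ordConnected_countLE D k).measurableSet
  have hF : Continuous F := continuous_finsetSum _ fun i _ =>
    continuous_const.mul (continuous_measureReal_Iio_Ico (h0 i))
  -- A fibre of `countLE D` not containing `x` lies entirely inside or outside `Iio x`, and likewise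
  -- for `f ⁻¹' Iio (f x)`, so it contributes nothing. On the fibre of `x` the two sets coincide.
  have hFf : ∀ x, F (f x) = F x := by
    intro x
    have h1 : F (f x) = ∑ i, a i * (μ i).real (f ⁻¹' Iio (f x)) := by
      refine Finset.sum_congr rfl fun i _ => ?_
      rw [measureReal_def, measureReal_def,
        (hμ i).measure_preimage measurableSet_Iio.nullMeasurableSet]
    by_cases hi : Nonempty ι
    swap
    · rw [not_nonempty_iff] at hi
      simp [F]
    rw [h1, sum_measureReal_eq_of_fiber hm ha ((hμ hi.some).measurable measurableSet_Iio)
      (k₀ := countLE D x)]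
    · rw [show F x = _ from sum_measureReal_eq_of_fiber hm ha measurableSet_Iio
        (k₀ := countLE D x) ?_]
      · refine Finset.sum_congr rfl fun i _ => ?_
        congr 2
        ext y
        refine and_congr_right fun hy => ?_
        exact (hf.isTranslationOn_countLE hD (countLE D x)).lt_iff_lt hy rfl
      · intro k hk y z hy hz hyx
        by_contra hzx
        have := (ordConnected_countLE D k).out hy hz ⟨le_of_lt hyx, not_lt.1 hzx⟩
        exact hk this.symm
    · intro k hk y z hy hz hyx
      refine ((hf.isTranslationOn_countLE hD k).lt_iff_lt_of_forall_ne
        (ordConnected_countLE D k) (fun w hw hwx => ?_) hy hz).1 hyx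
      obtain rfl := f.injective hwx
      exact hk (Eq.symm hw)
  let z : Ico (0 : ℝ) b := ⟨0, le_rfl, hb⟩
  have hFz : F z = 0 := by
    have : Iio z = ∅ := eq_empty_of_forall_notMem fun y hy => absurd y.2.1 (not_le.2 hy)
    simp [F, this]
  have hpow : ∀ n : ℕ, ∀ x, F ((f ^ n) x) = F x := by
    intro n
    induction n with
    | zero => intro x; rfl
    | succ n ih => intro x; rw [pow_succ', Equiv.Perm.mul_apply, hFf, ih]
  have hzpow : ∀ k : ℤ, F ((f ^ k) z) = 0 := by
    intro k
    obtain ⟨n, rfl | rfl⟩ := k.eq_nat_or_neg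
    · rw [zpow_natCast, hpow, hFz]
    · rw [← hpow n, ← Equiv.Perm.mul_apply, ← zpow_natCast, ← zpow_add, add_neg_cancel, zpow_zero,
        Equiv.Perm.one_apply, hFz]
  have : F = fun _ => 0 := by
    refine hF.ext_on (hmin z) continuous_const ?_
    rintro _ ⟨k, rfl⟩
    exact hzpow k
  exact congrFun this x

/-- A minimal interval exchange transformation has finitely many ergodic measures. -/
lemma IsIET.finite_ergodicMeasures (hb : 0 < b) (hf : IsIET f) (hmin : IsMinimalPerm f)
    (h0 : ∀ μ ∈ ergodicMeasures f, ∀ x, μ {x} = 0) : (ergodicMeasures f).Finite := by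
  classical
  by_contra hinf
  let D := hf.finite_discontinuities.toFinset
  have hD : ∀ x, x ∉ D → ContinuousAt f x := fun x hx =>
    not_not.1 fun h => hx (hf.finite_discontinuities.mem_toFinset.2 h)
  -- One more measure than there are fibres, which forces a linear relation between the mass
  -- vectors.
  obtain ⟨T, hT, hcard⟩ := Set.Infinite.exists_subset_card_eq hinf (D.card + 2)
  have hprob : ∀ i : T, IsProbabilityMeasure i.1 := fun i => (hT i.2).1
  have hm : ∀ k, MeasurableSet (countLE D ⁻¹' {k}) := fun k =>
    (ordConnected_countLE D k).measurableSet
  have hnonpos : ∀ a : T → ℝ, (∀ k, ∑ i, a i * i.1.real (countLE D ⁻¹' {k}) = 0) →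
      ∀ i, a i ≤ 0 := by
    intro a ha
    refine nonpos_of_measure_relation (C := range Iio)
      ((BorelSpace.measurable_eq (α := Ico (0 : ℝ) b)).trans (borel_eq_generateFrom_Iio _))
      isPiSystem_Iio (μ := fun i : T => i.1) ?_ (sum_measureReal_univ_eq_zero hm ha 0) ?_
    · exact fun i j hij => (hT i.2).2.mutuallySingular_of_ne (hT j.2).2
        fun h => hij (Subtype.ext h)
    · rintro _ ⟨x, rfl⟩
      exact hf.sum_measureReal_Iio_eq_zero hb hmin (fun i => (hT i.2).2.toMeasurePreserving)
        (fun i => h0 _ (hT i.2)) hD ha x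
  let v : T → Fin (D.card + 1) → ℝ := fun i k => i.1.real (countLE D ⁻¹' {k})
  have hdep : ¬ LinearIndependent ℝ v := by
    intro h
    have := h.fintype_card_le_finrank
    rw [Module.finrank_fin_fun, Fintype.card_coe, hcard] at this
    omega
  obtain ⟨a, ha, i, hi⟩ := Fintype.not_linearIndependent_iff.1 hdep
  have ha' : ∀ k, ∑ i, a i * i.1.real (countLE D ⁻¹' {k}) = 0 := by
    intro k
    have := congrFun ha k
    simpa [v] using this
  refine hi (le_antisymm (hnonpos a ha' i) ?_)
  have := hnonpos (-a) (fun k => by simpa using ha' k) i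
  simpa using this

/-! ### Genericity of weak mixing. -/

lemma IsIET.eventually_mem_weakMixingSet (hf : IsIET f) {μ : Measure (Ico (0 : ℝ) b)}
    [IsProbabilityMeasure μ] (hμ : Ergodic f μ) (hpos : ∀ u v, u < v → μ (Ico u v) ≠ 0)
    (h0 : ∀ x, μ {x} = 0) :
    ∀ᶠ t : Ico (0 : ℝ) b in residual _, 0 < (t : ℝ) → t ∈ weakMixingSet f μ := by
  have h : ∀ᶠ t : Ico (0 : ℝ) b in residual _,
      ∀ n : ℕ, SplitsVisits f μ (splitBound f) (1 / (n + 1)) t := by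
    rw [eventually_countable_forall]
    intro n
    exact mem_of_superset (residual_of_dense_open isOpen_interior
      (hf.dense_interior_splitsVisits hμ hpos h0 Nat.one_div_pos_of_nat)) interior_subset
  filter_upwards [h] with t ht ht0
  let z : Ico (0 : ℝ) b := ⟨0, le_rfl, ht0.trans t.2.2⟩
  have hA0 : μ (Iio t) ≠ 0 := fun h => hpos z t ht0 (measure_mono_null Ico_subset_Iio_self h)
  refine ⟨ht0, isWeaklyMixing_inducedMap hμ measurableSet_Iio hA0 fun θ G hG hG0 h1 h2 => ?_⟩
  refine eq_one_of_splitsVisits hμ.toMeasurePreserving ht hG hG0 ?_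
  filter_upwards [h1, h2] with x h1 h2
  split_ifs with hx
  · exact h1 hx
  · rw [one_mul]
    exact h2 hx

end

theorem theorem5 {b : ℝ} (hb : 0 < b) (f : Equiv.Perm (Set.Ico (0 : ℝ) b))
    (hf : IsIET f) (hmin : IsMinimalPerm f) :
    (ergodicMeasures f).Finite ∧
      {t : Set.Ico (0 : ℝ) b | 0 < (t : ℝ) ∧ ∀ μ ∈ ergodicMeasures f, t ∈ weakMixingSet f μ}
        ∈ residual (Set.Ico (0 : ℝ) b) := by
  let z : Ico (0 : ℝ) b := ⟨0, le_rfl, hb⟩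
  have : Nonempty (Ico (0 : ℝ) b) := ⟨z⟩
  have : Infinite (Ico (0 : ℝ) b) := NoMaxOrder.infinite
  have h0 : ∀ μ ∈ ergodicMeasures f, ∀ x, μ {x} = 0 := fun μ hμ x => by
    have := hμ.1
    exact hmin.measure_singleton hμ.2.toMeasurePreserving x
  have hfin := hf.finite_ergodicMeasures hb hmin h0
  refine ⟨hfin, ?_⟩
  have hwm : ∀ᶠ t : Ico (0 : ℝ) b in residual _, ∀ μ ∈ ergodicMeasures f,
      0 < (t : ℝ) → t ∈ weakMixingSet f μ := by
    rw [hfin.eventually_all]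
    intro μ hμ
    have := hμ.1
    refine hf.eventually_mem_weakMixingSet hμ.2 (fun u v huv hnull => ?_) (h0 μ hμ)
    exact hmin.measure_ne_zero (IsProbabilityMeasure.ne_zero μ) hμ.2.toMeasurePreserving isOpen_Ioo
      measurableSet_Ioo (nonempty_Ioo.2 huv) (measure_mono_null Ioo_subset_Ico_self hnull)
  have hpos : ∀ᶠ t : Ico (0 : ℝ) b in residual _, 0 < (t : ℝ) := by
    refine residual_of_dense_open (s := Ioi z) isOpen_Ioi ?_
    rw [dense_iff_inter_open]
    rintro U hU ⟨x, hx⟩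
    obtain ⟨y, hxy, hy⟩ := exists_Ico_subset_of_mem_nhds (hU.mem_nhds hx) (exists_gt x)
    obtain ⟨w, hw⟩ := exists_between hxy
    exact ⟨w, hy ⟨hw.1.le, hw.2⟩, lt_of_le_of_lt (show z ≤ x from x.2.1) hw.1⟩
  filter_upwards [hwm, hpos] with t ht ht0
  exact ⟨ht0, fun μ hμ => ht μ hμ ht0⟩
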